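/- All Hilbert spaces are complex, $n$ is a natural number, and $\oplus^n\mathcal H$ is the Hilbert direct sum of $n$ copies of $\mathcal H$. A row operator $T=(T_1,\dots,T_n):\oplus^n\mathcal H\to\mathcal H$ is a row contraction if $\|T\|\le 1$. For a contraction $C$ put $D_C=(I-C^*C)^{1/2}$ and $\mathcal D_C=\overline{\operatorname{ran}}\,D_C$. Let $\Gamma=\bigoplus_{m\ge 0}(\mathbb C^n)^{\otimes m}$ be the full Fock space, let $R_jf=f\otimes e_j$ be the right creation operators on $\Gamma$, and, for a row contraction $T$ on $\mathcal H$, let $\tilde R=(R_1\otimes I_{\mathcal H},\dots,R_n\otimes I_{\mathcal H})$ and $\tilde T=I_\Gamma\otimes T$, both operators $\Gamma\otimes(\oplus^n\mathcal H)\to\Gamma\otimes\mathcal H$. The characteristic function of $T$ is the operator $$\Theta_T=\mathrm{SOT}\text{-}\lim_{r\to1^-}\big[-\tilde T+(I_\Gamma\otimes D_{T^*})(I-r\tilde R\tilde T^*)^{-1}r\tilde R\,(I_\Gamma\otimes D_T)\big]:\ \Gamma\otimes\mathcal D_T\to\Gamma\otimes\mathcal D_{T^*}.$$ **Theorem.**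 Let $A$ and $B$ be row contractions on Hilbert spaces $\mathcal H_1$ and $\mathcal H_2$, let $L:\mathcal D_B\to\mathcal D_{A^*}$ be a contraction, and let $$T=\begin{bmatrix}A&D_{A^*}LD_B\\0&B\end{bmatrix}:(\oplus^n\mathcal H_1)\oplus(\oplus^n\mathcal H_2)\to\mathcal H_1\oplus\mathcal H_2,$$ regarded as a row operator on $\mathcal H_1\oplus\mathcal H_2$, be a row contraction. Then the limits defining $\Theta_A$, $\Theta_B$ and $\Theta_T$ exist; there are unique unitary operators $\sigma:\mathcal D_T\to\mathcal D_A\oplus\mathcal D_L$ and $\sigma_*:\mathcal D_{T^*}\to\mathcal D_{B^*}\oplus\mathcal D_{L^*}$ such that $$\sigma D_T=\begin{bmatrix}D_A&-A^*LD_B\\0&D_LD_B\end{bmatrix},\qquad \sigma_*D_{T^*}=\begin{bmatrix}-BL^*D_{A^*}&D_{B^*}\\D_{L^*}D_{A^*}&0\end{bmatrix};$$ and with these $$\Theta_T=(I_\Gamma\otimes\sigma_*^{-1})\begin{bmatrix}\Theta_B&0\\0&I_{\Gamma\otimes\mathcal D_{L^*}}\end{bmatrix}(I_\Gamma\otimes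 J_L)\begin{bmatrix}\Theta_A&0\\0&I_{\Gamma\otimes\mathcal D_L}\end{bmatrix}(I_\Gamma\otimes\sigma),$$ where $$J_L=\begin{bmatrix}L^*&D_L\\D_{L^*}&-L\end{bmatrix}:\ \mathcal D_{A^*}\oplus\mathcal D_L\to\mathcal D_B\oplus\mathcal D_{L^*}$$ is the Julia–Halmos matrix of $L$. -/

import Mathlib

open scoped ENNReal Topology
open Filter ContinuousLinearMap

namespace FockModel

noncomputable section

section Block

variable {E E₁ E₂ F F₁ F₂ : Type*}
  [NormedAddCommGroup E] [InnerProductSpace ℂ E]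
  [NormedAddCommGroup E₁] [InnerProductSpace ℂ E₁]
  [NormedAddCommGroup E₂] [InnerProductSpace ℂ E₂]
  [NormedAddCommGroup F] [InnerProductSpace ℂ F]
  [NormedAddCommGroup F₁] [InnerProductSpace ℂ F₁]
  [NormedAddCommGroup F₂] [InnerProductSpace ℂ F₂]

/-- The bounded operator `[[a, b], [c, d]] : E₁ ⊕ E₂ → F₁ ⊕ F₂` between Hilbert direct sums. -/
def blockOp (a : E₁ →L[ℂ] F₁) (b : E₂ →L[ℂ] F₁) (c : E₁ →L[ℂ] F₂) (d : E₂ →L[ℂ] F₂) :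
    WithLp 2 (E₁ × E₂) →L[ℂ] WithLp 2 (F₁ × F₂) :=
  ((WithLp.prodContinuousLinearEquiv 2 ℂ F₁ F₂).symm : F₁ × F₂ →L[ℂ] WithLp 2 (F₁ × F₂)) ∘L
    ((a ∘L WithLp.fstL 2 ℂ E₁ E₂ + b ∘L WithLp.sndL 2 ℂ E₁ E₂).prod
      (c ∘L WithLp.fstL 2 ℂ E₁ E₂ + d ∘L WithLp.sndL 2 ℂ E₁ E₂))

@[simp] lemma blockOp_fst (a : E₁ →L[ℂ] F₁) (b : E₂ →L[ℂ] F₁) (c : E₁ →L[ℂ] F₂)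
    (d : E₂ →L[ℂ] F₂) (x : WithLp 2 (E₁ × E₂)) :
    (blockOp a b c d x).fst = a x.fst + b x.snd := rfl

@[simp] lemma blockOp_snd (a : E₁ →L[ℂ] F₁) (b : E₂ →L[ℂ] F₁) (c : E₁ →L[ℂ] F₂)
    (d : E₂ →L[ℂ] F₂) (x : WithLp 2 (E₁ × E₂)) :
    (blockOp a b c d x).snd = c x.fst + d x.snd := rfl

/-- The inclusion of the first summand of a Hilbert direct sum. -/
def inlOp (E₁ E₂ : Type*) [NormedAddCommGroup E₁] [InnerProductSpace ℂ E₁]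
    [NormedAddCommGroup E₂] [InnerProductSpace ℂ E₂] : E₁ →L[ℂ] WithLp 2 (E₁ × E₂) :=
  ((WithLp.prodContinuousLinearEquiv 2 ℂ E₁ E₂).symm : E₁ × E₂ →L[ℂ] WithLp 2 (E₁ × E₂)) ∘L
    ContinuousLinearMap.inl ℂ E₁ E₂

/-- The inclusion of the second summand of a Hilbert direct sum. -/
def inrOp (E₁ E₂ : Type*) [NormedAddCommGroup E₁] [InnerProductSpace ℂ E₁]
    [NormedAddCommGroup E₂] [InnerProductSpace ℂ E₂] : E₂ →L[ℂ] WithLp 2 (E₁ × E₂) :=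
  ((WithLp.prodContinuousLinearEquiv 2 ℂ E₁ E₂).symm : E₁ × E₂ →L[ℂ] WithLp 2 (E₁ × E₂)) ∘L
    ContinuousLinearMap.inr ℂ E₁ E₂

/-- The Hilbert direct sum of `n` copies of `E`. -/
abbrev Copies (n : ℕ) (E : Type*) : Type _ := PiLp 2 (fun _ : Fin n => E)

/-- The canonical identification `⊕ⁿ (E₁ ⊕ E₂) → (⊕ⁿ E₁) ⊕ (⊕ⁿ E₂)`. -/
def shuffle (n : ℕ) (E₁ E₂ : Type*) [NormedAddCommGroup E₁] [InnerProductSpace ℂ E₁]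
    [NormedAddCommGroup E₂] [InnerProductSpace ℂ E₂] :
    Copies n (WithLp 2 (E₁ × E₂)) →L[ℂ] WithLp 2 (Copies n E₁ × Copies n E₂) :=
  ((WithLp.prodContinuousLinearEquiv 2 ℂ (Copies n E₁) (Copies n E₂)).symm :
      Copies n E₁ × Copies n E₂ →L[ℂ] WithLp 2 (Copies n E₁ × Copies n E₂)) ∘L
    (((PiLp.continuousLinearEquiv 2 ℂ (fun _ : Fin n => E₁)).symm ∘L
        ContinuousLinearMap.pi fun j => WithLp.fstL 2 ℂ E₁ E₂ ∘L
          PiLp.proj 2 (fun _ : Fin n => WithLp 2 (E₁ × E₂)) j).prod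
      ((PiLp.continuousLinearEquiv 2 ℂ (fun _ : Fin n => E₂)).symm ∘L
        ContinuousLinearMap.pi fun j => WithLp.sndL 2 ℂ E₁ E₂ ∘L
          PiLp.proj 2 (fun _ : Fin n => WithLp 2 (E₁ × E₂)) j))

@[simp] lemma shuffle_fst_apply {n : ℕ} (h : Copies n (WithLp 2 (E₁ × E₂))) (j : Fin n) :
    (shuffle n E₁ E₂ h).fst j = (h j).fst := rfl

@[simp] lemma shuffle_snd_apply {n : ℕ} (h : Copies n (WithLp 2 (E₁ × E₂))) (j : Fin n) :
    (shuffle n E₁ E₂ h).snd j = (h j).snd := rfl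

end Block

section Defect

variable {E F : Type*}
  [NormedAddCommGroup E] [InnerProductSpace ℂ E] [CompleteSpace E]
  [NormedAddCommGroup F] [InnerProductSpace ℂ F] [CompleteSpace F]

/-- The defect operator `D_T = (I - T* T)^{1/2}` of a contraction `T : E → F`. -/
def defectOp (T : E →L[ℂ] F) : E →L[ℂ] E :=
  CFC.sqrt (1 - adjoint T ∘L T)

/-- The defect space `𝓓_T`, the closure of the range of `D_T`. -/
def defectSpace (T : E →L[ℂ] F) : Submodule ℂ E :=
  (LinearMap.range (defectOp T : E →ₗ[ℂ] E)).topologicalClosure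

instance (T : E →L[ℂ] F) : CompleteSpace (defectSpace T) :=
  (Submodule.isClosed_topologicalClosure _).completeSpace_coe

lemma defectOp_mem (T : E →L[ℂ] F) (x : E) : defectOp T x ∈ defectSpace T :=
  Submodule.le_topologicalClosure _ ⟨x, rfl⟩

/-- `D_T`, regarded as an operator from `E` onto a dense subspace of `𝓓_T`. -/
def toDefect (T : E →L[ℂ] F) : E →L[ℂ] defectSpace T :=
  (defectOp T).codRestrict (defectSpace T) (defectOp_mem T)

/-- `D_T`, restricted to `𝓓_T`, with values in `E`. -/
def fromDefect (T : E →L[ℂ] F) : defectSpace T →L[ℂ] E :=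
  defectOp T ∘L (defectSpace T).subtypeL

lemma one_sub_nonneg_iff (T : E →L[ℂ] F) : 0 ≤ 1 - adjoint T ∘L T ↔ ‖T‖ ≤ 1 := by
  have key : ∀ x, (1 - adjoint T ∘L T).reApplyInnerSelf x = ‖x‖ ^ 2 - ‖T x‖ ^ 2 := fun x => by
    simp [reApplyInnerSelf, inner_sub_left, adjoint_inner_left, ← Complex.ofReal_pow]
  rw [nonneg_iff_isPositive, isPositive_def, opNorm_le_iff zero_le_one]
  simp only [key, one_mul, sub_nonneg, sq_le_sq, abs_norm]
  refine and_iff_right fun x y => ?_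
  simp [inner_sub_left, inner_sub_right, adjoint_inner_left, adjoint_inner_right]

lemma commute_of_mul_self {P S : E →L[ℂ] E} (hP : 0 ≤ P) (h : Commute (P * P) S) :
    Commute P S := by
  have hs : CFC.sqrt (P * P) = P := CFC.sqrt_mul_self P hP
  rw [← hs]
  exact h.cfcₙ_nnreal NNReal.sqrt

/-- A contraction intertwines its defect operators. -/
lemma defectOp_intertwine (T : E →L[ℂ] F) :
    T ∘L defectOp T = defectOp (adjoint T) ∘L T := by
  by_cases hT : ‖T‖ ≤ 1
  · have h1 : 0 ≤ 1 - adjoint T ∘L T := (one_sub_nonneg_iff T).2 hT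
    have h2 : 0 ≤ 1 - adjoint (adjoint T) ∘L adjoint T :=
      (one_sub_nonneg_iff (adjoint T)).2 (by simpa using hT)
    have q1 : ∀ x, defectOp T (defectOp T x) = x - adjoint T (T x) := fun x =>
      DFunLike.congr_fun (CFC.sqrt_mul_sqrt_self _ h1) x
    have q2 : ∀ x, defectOp (adjoint T) (defectOp (adjoint T) x) = x - T (adjoint T x) :=
      fun x => by
        have := DFunLike.congr_fun (CFC.sqrt_mul_sqrt_self _ h2) x
        rw [adjoint_adjoint] at this
        simpa [defectOp] using this
    have p1 := (nonneg_iff_isPositive (defectOp T)).1 (CFC.sqrt_nonneg _)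
    have p2 := (nonneg_iff_isPositive (defectOp (adjoint T))).1 (CFC.sqrt_nonneg _)
    let P := blockOp (defectOp T) 0 0 (defectOp (adjoint T))
    let S : WithLp 2 (E × F) →L[ℂ] WithLp 2 (E × F) := blockOp 0 0 T 0
    have hP : 0 ≤ P := by
      rw [nonneg_iff_isPositive, isPositive_def]
      refine ⟨fun x y => ?_, fun x => ?_⟩
      · have e1 := p1.1 x.fst y.fst
        have e2 := p2.1 x.snd y.snd
        simp only [coe_coe] at e1 e2
        simp [P, WithLp.prod_inner_apply, e1, e2]
      · have e1 := p1.2 x.fst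
        have e2 := p2.2 x.snd
        simp only [reApplyInnerSelf] at e1 e2 ⊢
        simp only [P, WithLp.prod_inner_apply, map_add]
        simpa using add_nonneg e1 e2
    have hPS : Commute P S := by
      have hc : Commute (P * P) S := by
        refine ContinuousLinearMap.ext fun x => WithLp.ofLp_injective 2 (Prod.ext ?_ ?_)
        · change (P (P (S x))).fst = (S (P (P x))).fst
          simp [P, S]
        · change (P (P (S x))).snd = (S (P (P x))).snd
          simp [P, S, q1, q2]
      exact commute_of_mul_self hP hc
    ext x
    have := congrArg WithLp.snd (DFunLike.congr_fun hPS (inlOp E F x))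
    simpa [P, S, inlOp] using this.symm
  · have h1 : ¬ 0 ≤ 1 - adjoint T ∘L T := fun h => hT ((one_sub_nonneg_iff T).1 h)
    have h2 : ¬ 0 ≤ 1 - adjoint (adjoint T) ∘L adjoint T := fun h =>
      hT (by simpa using (one_sub_nonneg_iff (adjoint T)).1 h)
    simp only [defectOp, CFC.sqrt_of_not_nonneg h1, CFC.sqrt_of_not_nonneg h2]
    simp

lemma map_mem_defectSpace (T : E →L[ℂ] F) (x : defectSpace T) :
    T x ∈ defectSpace (adjoint T) := by
  obtain ⟨x, hx⟩ := x
  have h : Set.MapsTo T (LinearMap.range (defectOp T : E →ₗ[ℂ] E))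
      (LinearMap.range (defectOp (adjoint T) : F →ₗ[ℂ] F)) := by
    rintro _ ⟨y, rfl⟩
    exact ⟨T y, (DFunLike.congr_fun (defectOp_intertwine T) y).symm⟩
  exact h.closure T.continuous hx

/-- The restriction `T : 𝓓_T → 𝓓_{T*}`. -/
def defectRestrict (T : E →L[ℂ] F) : defectSpace T →L[ℂ] defectSpace (adjoint T) :=
  (T ∘L (defectSpace T).subtypeL).codRestrict _ (map_mem_defectSpace T)

/-- The Julia-Halmos matrix `J_L = [[L*, D_L], [D_{L*}, -L]] : F ⊕ 𝓓_L → E ⊕ 𝓓_{L*}` of a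
contraction `L : E → F`. -/
def juliaHalmos (L : E →L[ℂ] F) :
    WithLp 2 (F × defectSpace L) →L[ℂ] WithLp 2 (E × defectSpace (adjoint L)) :=
  blockOp (adjoint L) (fromDefect L) (toDefect (adjoint L)) (-defectRestrict L)

end Defect

section Fock

variable {n : ℕ} {E F E₁ E₂ F₁ F₂ : Type*}
  [NormedAddCommGroup E] [InnerProductSpace ℂ E]
  [NormedAddCommGroup F] [InnerProductSpace ℂ F]
  [NormedAddCommGroup E₁] [InnerProductSpace ℂ E₁]
  [NormedAddCommGroup E₂] [InnerProductSpace ℂ E₂]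
  [NormedAddCommGroup F₁] [InnerProductSpace ℂ F₁]
  [NormedAddCommGroup F₂] [InnerProductSpace ℂ F₂]

/-- The Hilbert space tensor product `Γ ⊗ E` of the full Fock space `Γ` over `ℂⁿ` and `E`. Since
the `e_α`, for `α` a word in the letters `1, …, n`, are an orthonormal basis of `Γ`, it is the
space of square summable families `(x_α)` in `E`, where `(x_α)` stands for `∑ e_α ⊗ x_α`;
`Fock n ℂ` is `Γ` itself. The elementary tensors are `Fock.tmul`. -/
abbrev Fock (n : ℕ) (E : Type*) [NormedAddCommGroup E] : Type _ :=
  lp (fun _ : FreeMonoid (Fin n) => E) 2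

/-- The operator `I_Γ ⊗ S`. -/
def fockMap (n : ℕ) (S : E →L[ℂ] F) : Fock n E →L[ℂ] Fock n F :=
  LinearMap.mkContinuous
    { toFun := fun f => ⟨fun α => S (f α),
        ((lp.memℓp f).norm.const_mul ‖S‖).mono fun α => S.le_opNorm (f α)⟩
      map_add' := fun f g => lp.ext (funext fun α => S.map_add (f α) (g α))
      map_smul' := fun c f => lp.ext (funext fun α => S.map_smul c (f α)) }
    ‖S‖ (fun f => by
      refine lp.norm_le_of_forall_sum_le (by norm_num) (by positivity) fun s => ?_
      calc ∑ α ∈ s, ‖S (f α)‖ ^ (2 : ℝ≥0∞).toReal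
          ≤ ∑ α ∈ s, ‖S‖ ^ (2 : ℝ≥0∞).toReal * ‖f α‖ ^ (2 : ℝ≥0∞).toReal := by
            refine Finset.sum_le_sum fun α _ => ?_
            rw [← Real.mul_rpow (norm_nonneg _) (norm_nonneg _)]
            gcongr
            exact S.le_opNorm _
        _ ≤ (‖S‖ * ‖f‖) ^ (2 : ℝ≥0∞).toReal := by
            rw [← Finset.mul_sum, Real.mul_rpow (norm_nonneg _) (norm_nonneg _)]
            gcongr
            exact lp.sum_rpow_le_norm_rpow (by norm_num) f s)

@[simp] lemma fockMap_apply (S : E →L[ℂ] F) (f : Fock n E) (α : FreeMonoid (Fin n)) :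
    fockMap n S f α = S (f α) := rfl

set_option linter.unusedSectionVars false in
lemma hasSum_extend (j : Fin n) (f : Fock n E) :
    HasSum (fun α => ‖Function.extend (fun α => α * FreeMonoid.of j) f 0 α‖ ^ (2 : ℝ≥0∞).toReal)
      (‖f‖ ^ (2 : ℝ≥0∞).toReal) := by
  have hj : Function.Injective fun α : FreeMonoid (Fin n) => α * FreeMonoid.of j :=
    mul_left_injective _
  refine (hj.hasSum_iff fun x hx => ?_).1 ?_
  · rw [Function.extend_apply' _ _ _ hx]
    norm_num
  · convert lp.hasSum_norm (p := 2) (by norm_num) f using 2 with α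
    simp [hj.extend_apply]

/-- The operator `R_j ⊗ I_E`, where `R_j` is the right creation operator `f ↦ f ⊗ e_j` on `Γ`: it
sends `e_α ⊗ x` to `e_{αj} ⊗ x`. -/
def rightCreation (j : Fin n) : Fock n E →L[ℂ] Fock n E :=
  LinearMap.mkContinuous
    { toFun := fun f => ⟨Function.extend (fun α => α * FreeMonoid.of j) f 0,
        memℓp_gen (hasSum_extend j f).summable⟩
      map_add' := fun f g => lp.ext <| by
        have := Function.extend_add (fun α => α * FreeMonoid.of j) (f : FreeMonoid (Fin n) → E) g 0 0
        rw [add_zero] at this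
        exact this
      map_smul' := fun c f => lp.ext <| by
        have := Function.extend_smul c (fun α => α * FreeMonoid.of j) (f : FreeMonoid (Fin n) → E) 0
        rw [smul_zero] at this
        exact this }
    1 (fun f => by
      rw [one_mul]
      refine lp.norm_le_of_tsum_le (by norm_num) (norm_nonneg f) ?_
      exact (hasSum_extend j f).tsum_eq.le)

/-- The row operator `R̃ = (R_1 ⊗ I_E, …, R_n ⊗ I_E)`, on `Γ ⊗ (⊕ⁿ E) = ⊕ⁿ (Γ ⊗ E)`. -/
def rightRow (n : ℕ) (E : Type*) [NormedAddCommGroup E] [InnerProductSpace ℂ E] :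
    Fock n (Copies n E) →L[ℂ] Fock n E :=
  ∑ j : Fin n, rightCreation j ∘L fockMap n (PiLp.proj 2 (fun _ : Fin n => E) j)

/-- The operator `diag(M, N)` from `Γ ⊗ (E₁ ⊕ E₂) = (Γ ⊗ E₁) ⊕ (Γ ⊗ E₂)` to
`Γ ⊗ (F₁ ⊕ F₂) = (Γ ⊗ F₁) ⊕ (Γ ⊗ F₂)`. -/
def fockDiag (M : Fock n E₁ →L[ℂ] Fock n F₁) (N : Fock n E₂ →L[ℂ] Fock n F₂) :
    Fock n (WithLp 2 (E₁ × E₂)) →L[ℂ] Fock n (WithLp 2 (F₁ × F₂)) :=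
  fockMap n (inlOp F₁ F₂) ∘L M ∘L fockMap n (WithLp.fstL 2 ℂ E₁ E₂) +
    fockMap n (inrOp F₁ F₂) ∘L N ∘L fockMap n (WithLp.sndL 2 ℂ E₁ E₂)

/-- The elementary tensor `f ⊗ x`, for `f ∈ Γ` and `x ∈ E`. -/
def Fock.tmul (f : Fock n ℂ) (x : E) : Fock n E :=
  fockMap n (ContinuousLinearMap.toSpanSingleton ℂ x) f

lemma Fock.tmul_apply (f : Fock n ℂ) (x : E) (α : FreeMonoid (Fin n)) :
    Fock.tmul f x α = f α • x := rfl

/-- The inner product of elementary tensors is the product of the inner products. -/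
lemma Fock.inner_tmul (f g : Fock n ℂ) (x y : E) :
    inner ℂ (Fock.tmul f x) (Fock.tmul g y) = inner ℂ f g * inner ℂ x y := by
  refine (lp.hasSum_inner (𝕜 := ℂ) (Fock.tmul f x) (Fock.tmul g y)).unique ?_
  have e : (fun α => inner ℂ (Fock.tmul f x α) (Fock.tmul g y α)) =
      fun α => inner ℂ (f α) (g α) * inner ℂ x y := funext fun α => by
    change inner ℂ (f α • x) (g α • y) = _
    simp only [inner_smul_left, inner_smul_right, RCLike.inner_apply]
    ring
  rw [e]
  exact (lp.hasSum_inner (𝕜 := ℂ) f g).mul_right (inner ℂ x y)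

/-- The elementary tensors span a dense subspace. -/
lemma Fock.span_tmul_dense :
    (Submodule.span ℂ (Set.range fun p : Fock n ℂ × E => Fock.tmul p.1 p.2)).topologicalClosure
      = ⊤ := by
  classical
  refine eq_top_iff.2 fun f _ => ?_
  refine mem_closure_of_tendsto (lp.hasSum_single (p := 2) (by norm_num) f)
    (Eventually.of_forall fun s => Submodule.sum_mem _ fun α _ => Submodule.subset_span
      ⟨(lp.single 2 α 1, f α), lp.ext (funext fun β => ?_)⟩)
  by_cases h : β = α
  · subst h
    simp [Fock.tmul_apply]
  · simp [Fock.tmul_apply, h]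

lemma fockMap_tmul (S : E →L[ℂ] F) (f : Fock n ℂ) (x : E) :
    fockMap n S (Fock.tmul f x) = Fock.tmul f (S x) :=
  lp.ext (funext fun α => S.map_smul (f α) x)

lemma rightCreation_single [DecidableEq (FreeMonoid (Fin n))] (j : Fin n)
    (α : FreeMonoid (Fin n)) (x : E) :
    rightCreation j (lp.single 2 α x : Fock n E) = lp.single 2 (α * FreeMonoid.of j) x := by
  refine lp.ext (funext fun β => ?_)
  change Function.extend (fun α => α * FreeMonoid.of j) _ 0 β = _
  have hj : Function.Injective fun α : FreeMonoid (Fin n) => α * FreeMonoid.of j :=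
    mul_left_injective _
  by_cases h : ∃ γ, γ * FreeMonoid.of j = β
  · obtain ⟨γ, rfl⟩ := h
    rw [hj.extend_apply]
    by_cases h' : γ = α
    · subst h'
      simp
    · simp [h']
  · rw [Function.extend_apply' _ _ _ h, lp.single_apply_ne _ _ _ (fun h' => h ⟨α, h'.symm⟩)]
    rfl

end Fock

section Characteristic

variable {n : ℕ} {H : Type*} [NormedAddCommGroup H] [InnerProductSpace ℂ H] [CompleteSpace H]

/-- A row operator `T = (T_1, …, T_n) : ⊕ⁿ H → H` is a row contraction if `‖T‖ ≤ 1`. -/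
def IsRowContraction (T : Copies n H →L[ℂ] H) : Prop := ‖T‖ ≤ 1

/-- `Θ_T(rR) = -T̃ + D_{T̃*} (I - r R̃ T̃*)⁻¹ r R̃ D_{T̃} : Γ ⊗ 𝓓_T → Γ ⊗ 𝓓_{T*}`, where `T̃ = I_Γ ⊗ T`.
For a row contraction `T` and `0 ≤ r < 1` the operator `I - r R̃ T̃*` is invertible. -/
def charFunAt (T : Copies n H →L[ℂ] H) (r : ℝ) :
    Fock n (defectSpace T) →L[ℂ] Fock n (defectSpace (adjoint T)) :=
  -fockMap n (defectRestrict T) +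
    fockMap n (toDefect (adjoint T)) ∘L
      Ring.inverse (1 - (r : ℂ) • (rightRow n H ∘L fockMap n (adjoint T))) ∘L
        ((r : ℂ) • rightRow n H) ∘L fockMap n (fromDefect T)

/-- `Θ` is the limit of `Θ_T(rR)` as `r → 1⁻`, in the strong operator topology. -/
def IsCharFun (T : Copies n H →L[ℂ] H)
    (Θ : Fock n (defectSpace T) →L[ℂ] Fock n (defectSpace (adjoint T))) : Prop :=
  ∀ f, Tendsto (fun r : ℝ => charFunAt T r f) (𝓝[<] 1) (𝓝 (Θ f))

open Classical in
/-- The characteristic function `Θ_T = SOT-lim_{r → 1⁻} Θ_T(rR)` of a row contraction `T`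
(and `0` where the limit does not exist, which does not happen for row contractions). -/
def charFun (T : Copies n H →L[ℂ] H) :
    Fock n (defectSpace T) →L[ℂ] Fock n (defectSpace (adjoint T)) :=
  if h : ∃ Θ, IsCharFun T Θ then h.choose else 0

end Characteristic

section Triangular

variable {n : ℕ} {H₁ H₂ : Type*}
  [NormedAddCommGroup H₁] [InnerProductSpace ℂ H₁] [CompleteSpace H₁]
  [NormedAddCommGroup H₂] [InnerProductSpace ℂ H₂] [CompleteSpace H₂]

/-- The row operator `[[A, D_{A*} L D_B], [0, B]]` on `H₁ ⊕ H₂`. -/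
def triangular (A : Copies n H₁ →L[ℂ] H₁) (B : Copies n H₂ →L[ℂ] H₂)
    (L : defectSpace B →L[ℂ] defectSpace (adjoint A)) :
    Copies n (WithLp 2 (H₁ × H₂)) →L[ℂ] WithLp 2 (H₁ × H₂) :=
  blockOp A (fromDefect (adjoint A) ∘L L ∘L toDefect B) 0 B ∘L shuffle n H₁ H₂

/-- `σ D_T = [[D_A, -A* L D_B], [0, D_L D_B]]`, for an operator `σ : 𝓓_T → 𝓓_A ⊕ 𝓓_L`; here `T`
is `[[A, D_{A*} L D_B], [0, B]]`. -/
def IsSigma (T : Copies n (WithLp 2 (H₁ × H₂)) →L[ℂ] WithLp 2 (H₁ × H₂))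
    (A : Copies n H₁ →L[ℂ] H₁) (B : Copies n H₂ →L[ℂ] H₂)
    (L : defectSpace B →L[ℂ] defectSpace (adjoint A))
    (σ : defectSpace T ≃ₗᵢ[ℂ] WithLp 2 (defectSpace A × defectSpace L)) : Prop :=
  ∀ h : Copies n (WithLp 2 (H₁ × H₂)),
    ((σ (toDefect T h)).fst : Copies n H₁) =
        defectOp A (shuffle n H₁ H₂ h).fst -
          adjoint A (L (toDefect B (shuffle n H₁ H₂ h).snd)) ∧
      (σ (toDefect T h)).snd = toDefect L (toDefect B (shuffle n H₁ H₂ h).snd)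

/-- `σ_* D_{T*} = [[-B L* D_{A*}, D_{B*}], [D_{L*} D_{A*}, 0]]`, for an operator
`σ_* : 𝓓_{T*} → 𝓓_{B*} ⊕ 𝓓_{L*}`; here `T` is `[[A, D_{A*} L D_B], [0, B]]`. -/
def IsSigmaStar (T : Copies n (WithLp 2 (H₁ × H₂)) →L[ℂ] WithLp 2 (H₁ × H₂))
    (A : Copies n H₁ →L[ℂ] H₁) (B : Copies n H₂ →L[ℂ] H₂)
    (L : defectSpace B →L[ℂ] defectSpace (adjoint A))
    (σ' : defectSpace (adjoint T) ≃ₗᵢ[ℂ]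
      WithLp 2 (defectSpace (adjoint B) × defectSpace (adjoint L))) : Prop :=
  ∀ h : WithLp 2 (H₁ × H₂),
    ((σ' (toDefect (adjoint T) h)).fst : H₂) =
        -B (adjoint L (toDefect (adjoint A) h.fst)) + defectOp (adjoint B) h.snd ∧
      (σ' (toDefect (adjoint T) h)).snd = toDefect (adjoint L) (toDefect (adjoint A) h.fst)

end Triangular

end

end FockModel

open FockModel

namespace FockModel

/-! ### Coefficients in the Fock space and the isometry `rightRow`. -/

section FockSpace

variable {n : ℕ} {E F : Type*}
  [NormedAddCommGroup E] [InnerProductSpace ℂ E]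
  [NormedAddCommGroup F] [InnerProductSpace ℂ F]

/-! `Θ_T` is the transfer function of the isometric colligation `[[T*, D_T], [D_{T*}, -T]]`. For an
input `f` the state `U` is given by `U(1) = 0` and `U(αj) = (T* U(α) + D_T f(α))_j`, and the output
at the word `α` is `-T f(α) + D_{T*} U(α)`. `U` need not be square summable, so everything is done
coefficient by coefficient, by induction on words.

Existence of the limit: for `0 < r < 1` the state obeys the same recursion with an extra factor `r`
(`charFunState_mul_of`), and the isometric colligation gives `‖Θ_T(rR)‖ ≤ 1` (`norm_charFunAt_le`).
On `e_γ ⊗ x` the coefficients depend on `r` only through powers of `r`, so the limit exists there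
(`exists_tendsto_charFunAt_single`); the uniform bound carries it to all vectors.

Factorization: the colligation identities for `A` and `B` give `‖σ D_T h‖ = ‖D_T h‖` and its
analogue for `σ_*`, so the two matrices define unitaries (`existsUnique_isometryEquiv`). In these
coordinates the colligation of `T` is the cascade of those of `A` and `B`, coupled by `J_L` (`ε_eq`,
`sigmaStar_τ_fst`, `sigmaStar_τ_snd`). Hence the state of `T` is the pair of the states of `A` and
`B`, and the outputs agree (`transfer_eq`). This part uses only the algebraic relations collected in
`DefectModel`, which are symmetric under passing to adjoints. -/

set_option linter.unusedSectionVars false in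
lemma Fock.hasSum_norm_sq (f : Fock n E) : HasSum (fun α => ‖f α‖ ^ 2) (‖f‖ ^ 2) := by
  simpa using lp.hasSum_norm (p := 2) (by norm_num) f

lemma norm_fockMap_le (S : E →L[ℂ] F) : ‖fockMap n S‖ ≤ ‖S‖ :=
  LinearMap.mkContinuous_norm_le _ (norm_nonneg S) _

-- Right creation appends a letter at the end of a word, so the recursions below peel off the last
-- letter.
@[elab_as_elim]
lemma freeMonoid_reverse_induction {X : Type*} {motive : FreeMonoid X → Prop}
    (one : motive 1) (mul_of : ∀ α j, motive α → motive (α * FreeMonoid.of j))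
    (α : FreeMonoid X) : motive α :=
  List.reverseRecOn (motive := fun l => motive (FreeMonoid.ofList l)) α.toList one
    fun l j h => mul_of (FreeMonoid.ofList l) j h

lemma rightCreation_apply_one (j : Fin n) (f : Fock n E) : rightCreation j f 1 = 0 := by
  change Function.extend (fun α => α * FreeMonoid.of j) f 0 1 = 0
  rw [Function.extend_apply']
  · rfl
  · rintro ⟨α, h⟩
    simpa using congrArg FreeMonoid.length h

lemma rightCreation_apply_mul_of (i j : Fin n) (f : Fock n E) (α : FreeMonoid (Fin n)) :
    rightCreation i f (α * FreeMonoid.of j) = if i = j then f α else 0 := by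
  change Function.extend (fun α => α * FreeMonoid.of i) f 0 (α * FreeMonoid.of j) = _
  have hi : Function.Injective fun α : FreeMonoid (Fin n) => α * FreeMonoid.of i :=
    mul_left_injective _
  split_ifs with h
  · subst h
    exact hi.extend_apply _ _ α
  · rw [Function.extend_apply']
    · rfl
    · rintro ⟨β, hβ⟩
      have h2 := congrArg (fun γ => (FreeMonoid.toList γ).getLast?) hβ
      simp only [FreeMonoid.toList_mul, FreeMonoid.toList_of, List.getLast?_append] at h2
      exact h (by simpa using h2)

lemma rightRow_apply (g : Fock n (Copies n E)) (β : FreeMonoid (Fin n)) :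
    rightRow n E g β =
      ∑ j, rightCreation j (fockMap n (PiLp.proj 2 (fun _ : Fin n => E) j) g) β := by
  rw [rightRow, sum_apply, lp.coeFn_sum]
  exact Finset.sum_apply _ _ _

@[simp] lemma rightRow_apply_one (g : Fock n (Copies n E)) : rightRow n E g 1 = 0 := by
  simp [rightRow_apply, rightCreation_apply_one]

@[simp] lemma rightRow_apply_mul_of (g : Fock n (Copies n E)) (α : FreeMonoid (Fin n))
    (j : Fin n) : rightRow n E g (α * FreeMonoid.of j) = g α j := by
  simp [rightRow_apply, rightCreation_apply_mul_of]

lemma norm_rightCreation_apply (j : Fin n) (f : Fock n E) : ‖rightCreation j f‖ = ‖f‖ := by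
  have h1 := lp.hasSum_norm (p := 2) (by norm_num) (rightCreation j f)
  have h2 := h1.unique (hasSum_extend j f)
  simpa using h2

/-- The row `R̃` of right creation operators is an isometry. -/
lemma norm_rightRow_apply (g : Fock n (Copies n E)) : ‖rightRow n E g‖ = ‖g‖ := by
  set c : Fin n → Fock n E := fun j => fockMap n (PiLp.proj 2 (fun _ : Fin n => E) j) g with hc
  -- A nonempty word has exactly one last letter, so at most one summand is nonzero at each `β`: the
  -- ranges of the creation operators are orthogonal.
  have hpt : ∀ β, ‖rightRow n E g β‖ ^ 2 = ∑ j, ‖rightCreation j (c j) β‖ ^ 2 := by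
    intro β
    induction β using freeMonoid_reverse_induction with
    | one => simp [rightCreation_apply_one]
    | mul_of α j _ =>
      rw [rightRow_apply_mul_of, Finset.sum_eq_single j]
      · simp [rightCreation_apply_mul_of, hc]
      · intro i _ hij
        simp [rightCreation_apply_mul_of, hij]
      · simp
  have h1 : HasSum (fun β => ‖rightRow n E g β‖ ^ 2) (∑ j, ‖c j‖ ^ 2) := by
    simp_rw [hpt]
    refine hasSum_sum fun j _ => ?_
    rw [← norm_rightCreation_apply j (c j)]
    exact Fock.hasSum_norm_sq _
  have h2 : HasSum (fun α => ‖g α‖ ^ 2) (∑ j, ‖c j‖ ^ 2) := by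
    have : ∀ α, ‖g α‖ ^ 2 = ∑ j, ‖c j α‖ ^ 2 := fun α => by
      rw [PiLp.norm_sq_eq_of_L2]
      rfl
    simp_rw [this]
    exact hasSum_sum fun j _ => Fock.hasSum_norm_sq _
  have h3 := h1.unique (Fock.hasSum_norm_sq _)
  have h4 := h2.unique (Fock.hasSum_norm_sq _)
  exact (sq_eq_sq₀ (norm_nonneg _) (norm_nonneg _)).1 (h3.symm.trans h4)

lemma norm_rightRow_le : ‖rightRow n E‖ ≤ 1 :=
  opNorm_le_bound _ zero_le_one fun g => by rw [norm_rightRow_apply, one_mul]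

/-- If `r ^ |β| f(β)` is, for `r < 1`, the family of coefficients of `F r`, then `F r` tends to `f`
as `r → 1⁻`. -/
lemma Fock.tendsto_of_gauge (f : Fock n E) (F : ℝ → Fock n E)
    (hF : ∀ᶠ r in 𝓝[<] (1 : ℝ), ∀ β, F r β = ((r : ℂ) ^ β.length) • f β) :
    Tendsto F (𝓝[<] 1) (𝓝 f) := by
  have h01 : ∀ᶠ r in 𝓝[<] (1 : ℝ), r ∈ Set.Ioo (0 : ℝ) 1 := Ioo_mem_nhdsLT zero_lt_one
  have hlim : Tendsto (fun r => ∑' β, ‖(F r - f) β‖ ^ 2) (𝓝[<] 1)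
      (𝓝 (∑' _ : FreeMonoid (Fin n), (0 : ℝ))) := by
    -- The dominating family is `‖f β‖ ^ 2`, because `|r ^ k - 1| ≤ 1` for `0 < r < 1`.
    refine tendsto_tsum_of_dominated_convergence (Fock.hasSum_norm_sq f).summable
      (fun β => ?_) ?_
    · have hc : Tendsto (fun r : ℝ => ‖((r : ℂ) ^ β.length) • f β - f β‖ ^ 2) (𝓝[<] 1)
          (𝓝 (‖(((1 : ℝ) : ℂ) ^ β.length) • f β - f β‖ ^ 2)) :=
        tendsto_nhdsWithin_of_tendsto_nhds (Continuous.tendsto (by fun_prop) 1)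
      simp only [Complex.ofReal_one, one_pow, one_smul, sub_self, norm_zero, ne_eq,
        OfNat.ofNat_ne_zero, not_false_eq_true, zero_pow] at hc
      refine hc.congr' ?_
      filter_upwards [hF] with r hr
      simp [hr β]
    · filter_upwards [hF, h01] with r hr h01 β
      have e : (F r - f) β = ((r ^ β.length - 1 : ℝ) : ℂ) • f β := by
        simp [hr β, sub_smul]
      have h1 : |r ^ β.length - 1| ≤ 1 := by
        have := pow_le_one₀ (n := β.length) h01.1.le h01.2.le
        have := pow_nonneg h01.1.le β.length
        rw [abs_le]
        constructor <;> linarith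
      rw [e, Real.norm_of_nonneg (sq_nonneg _), norm_smul, Complex.norm_real, Real.norm_eq_abs,
        mul_pow]
      exact mul_le_of_le_one_left (sq_nonneg _) (pow_le_one₀ (abs_nonneg _) h1)
  rw [tsum_zero] at hlim
  simp only [(Fock.hasSum_norm_sq _).tsum_eq] at hlim
  rw [tendsto_iff_norm_sub_tendsto_zero]
  simpa using hlim.sqrt

end FockSpace

/-! ### Defect operators and the colligation of a contraction. -/

section Defect

variable {E F : Type*}
  [NormedAddCommGroup E] [InnerProductSpace ℂ E] [CompleteSpace E]
  [NormedAddCommGroup F] [InnerProductSpace ℂ F] [CompleteSpace F]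

lemma inner_defectOp_left (T : E →L[ℂ] F) (x y : E) :
    inner ℂ (defectOp T x) y = inner ℂ x (defectOp T y) :=
  ((nonneg_iff_isPositive (defectOp T)).1 (CFC.sqrt_nonneg _)).1 x y

lemma defectOp_defectOp {T : E →L[ℂ] F} (hT : ‖T‖ ≤ 1) (x : E) :
    defectOp T (defectOp T x) = x - adjoint T (T x) :=
  DFunLike.congr_fun (CFC.sqrt_mul_sqrt_self _ ((one_sub_nonneg_iff T).2 hT)) x

lemma norm_adjoint_le_one {T : E →L[ℂ] F} (hT : ‖T‖ ≤ 1) : ‖adjoint T‖ ≤ 1 := by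
  simpa using hT

lemma defectOp_adjoint_defectOp_adjoint {T : E →L[ℂ] F} (hT : ‖T‖ ≤ 1) (x : F) :
    defectOp (adjoint T) (defectOp (adjoint T) x) = x - T (adjoint T x) := by
  simpa using defectOp_defectOp (norm_adjoint_le_one hT) x

lemma apply_defectOp (T : E →L[ℂ] F) (x : E) : T (defectOp T x) = defectOp (adjoint T) (T x) :=
  DFunLike.congr_fun (defectOp_intertwine T) x

lemma adjoint_apply_defectOp_adjoint (T : E →L[ℂ] F) (x : F) :
    adjoint T (defectOp (adjoint T) x) = defectOp T (adjoint T x) := by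
  simpa using apply_defectOp (adjoint T) x

/-- The colligation `[[T*, D_T], [D_{T*}, -T]]` of a contraction is isometric. -/
lemma norm_sq_colligation {T : E →L[ℂ] F} (hT : ‖T‖ ≤ 1) (u : F) (f : E) :
    ‖adjoint T u + defectOp T f‖ ^ 2 + ‖-T f + defectOp (adjoint T) u‖ ^ 2 =
      ‖u‖ ^ 2 + ‖f‖ ^ 2 := by
  have h : (inner ℂ (adjoint T u + defectOp T f) (adjoint T u + defectOp T f) +
      inner ℂ (-T f + defectOp (adjoint T) u) (-T f + defectOp (adjoint T) u) : ℂ) =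
      inner ℂ u u + inner ℂ f f := by
    simp only [inner_add_left, inner_add_right, inner_defectOp_left, inner_neg_left,
      inner_neg_right, adjoint_inner_left, defectOp_defectOp hT,
      defectOp_adjoint_defectOp_adjoint hT, inner_sub_right, apply_defectOp,
      ← adjoint_inner_right T f, adjoint_adjoint]
    ring
  simp only [inner_self_eq_norm_sq_to_K] at h
  exact_mod_cast h

end Defect

/-- For eventually contractive operators the set of convergence is closed: near a point `z` of
convergence, `g i x` eventually stays in a small ball about the limit at `z`, so it is Cauchy. -/
lemma exists_tendsto_of_mem_closure {ι E F : Type*} [NormedAddCommGroup E] [NormedSpace ℂ E]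
    [NormedAddCommGroup F] [NormedSpace ℂ F] [CompleteSpace F] {l : Filter ι} [l.NeBot]
    {g : ι → E →L[ℂ] F} (hg : ∀ᶠ i in l, ‖g i‖ ≤ 1) {x : E}
    (hx : x ∈ closure {x | ∃ y, Tendsto (fun i => g i x) l (𝓝 y)}) :
    ∃ y, Tendsto (fun i => g i x) l (𝓝 y) := by
  rw [← cauchy_map_iff_exists_tendsto, Metric.cauchy_iff]
  refine ⟨inferInstance, fun ε hε => ?_⟩
  obtain ⟨z, ⟨y, hy⟩, hz⟩ := Metric.mem_closure_iff.1 hx (ε / 4) (by positivity)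
  have hball : ∀ᶠ i in l, g i x ∈ Metric.ball y (ε / 2) := by
    filter_upwards [hg, hy (Metric.ball_mem_nhds y (show 0 < ε / 4 by positivity))] with i hi hi'
    have h1 : dist (g i x) (g i z) ≤ dist x z := by
      rw [dist_eq_norm, dist_eq_norm, ← map_sub]
      exact ((g i).le_of_opNorm_le hi _).trans (one_mul _).le
    have h2 : dist (g i z) y < ε / 4 := hi'
    have := dist_triangle (g i x) (g i z) y
    rw [Metric.mem_ball]
    linarith
  refine ⟨_, hball, fun a ha b hb => ?_⟩
  have := dist_triangle_right a b y
  rw [Metric.mem_ball] at ha hb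
  linarith

/-! ### Existence of the characteristic function. -/

section Characteristic

variable {n : ℕ} {H : Type*} [NormedAddCommGroup H] [InnerProductSpace ℂ H] [CompleteSpace H]

/-- The vector `(I - r R̃ T̃*)⁻¹ r R̃ D_{T̃} f`. -/
noncomputable def charFunState (T : Copies n H →L[ℂ] H) (r : ℝ) (f : Fock n (defectSpace T)) :
    Fock n H :=
  Ring.inverse (1 - (r : ℂ) • (rightRow n H ∘L fockMap n (adjoint T)))
    (((r : ℂ) • rightRow n H) (fockMap n (fromDefect T) f))

lemma charFunAt_apply_coe (T : Copies n H →L[ℂ] H) (r : ℝ) (f : Fock n (defectSpace T))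
    (α : FreeMonoid (Fin n)) :
    (charFunAt T r f α : H) =
      -T (f α : Copies n H) + defectOp (adjoint T) (charFunState T r f α) := rfl

/-- Since `‖r R̃ T̃*‖ ≤ r < 1`, `Ring.inverse` is a genuine inverse, and the definition of the state
can be multiplied out. -/
lemma charFunState_eq {T : Copies n H →L[ℂ] H} (hT : ‖T‖ ≤ 1) {r : ℝ}
    (hr : r ∈ Set.Ioo (0 : ℝ) 1) (f : Fock n (defectSpace T)) :
    charFunState T r f = (r : ℂ) • rightRow n H
      (fockMap n (adjoint T) (charFunState T r f) + fockMap n (fromDefect T) f) := by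
  set X := rightRow n H ∘L fockMap n (adjoint T) with hX
  have hXn : ‖X‖ ≤ 1 :=
    (opNorm_comp_le _ _).trans (mul_le_one₀ norm_rightRow_le (norm_nonneg _)
      ((norm_fockMap_le _).trans (norm_adjoint_le_one hT)))
  have hn : ‖(r : ℂ) • X‖ < 1 := by
    rw [norm_smul, Complex.norm_real, Real.norm_of_nonneg hr.1.le]
    exact (mul_le_of_le_one_right hr.1.le hXn).trans_lt hr.2
  have hu : IsUnit (1 - (r : ℂ) • X) := isUnit_one_sub_of_norm_lt_one hn
  have h := DFunLike.congr_fun (Ring.mul_inverse_cancel _ hu)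
    (((r : ℂ) • rightRow n H) (fockMap n (fromDefect T) f))
  have h' : charFunState T r f - (r : ℂ) • X (charFunState T r f) =
    (r : ℂ) • rightRow n H (fockMap n (fromDefect T) f) := h
  rw [map_add, smul_add, ← h', hX]
  simp

lemma charFunState_one {T : Copies n H →L[ℂ] H} (hT : ‖T‖ ≤ 1) {r : ℝ}
    (hr : r ∈ Set.Ioo (0 : ℝ) 1) (f : Fock n (defectSpace T)) : charFunState T r f 1 = 0 := by
  rw [charFunState_eq hT hr, lp.coeFn_smul, Pi.smul_apply, rightRow_apply_one, smul_zero]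

lemma charFunState_mul_of {T : Copies n H →L[ℂ] H} (hT : ‖T‖ ≤ 1) {r : ℝ}
    (hr : r ∈ Set.Ioo (0 : ℝ) 1) (f : Fock n (defectSpace T)) (α : FreeMonoid (Fin n))
    (j : Fin n) :
    charFunState T r f (α * FreeMonoid.of j) =
      (r : ℂ) • (adjoint T (charFunState T r f α) + defectOp T (f α)) j := by
  conv_lhs => rw [charFunState_eq hT hr]
  rw [lp.coeFn_smul, Pi.smul_apply, rightRow_apply_mul_of]
  rfl

/-- Summing the colligation identity over all words gives `‖w‖² + ‖Θ_T(rR) f‖² = ‖u‖² + ‖f‖²`, and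
`u = r R̃ w` with `R̃` isometric forces `‖u‖ ≤ ‖w‖`. -/
lemma norm_charFunAt_le {T : Copies n H →L[ℂ] H} (hT : ‖T‖ ≤ 1) {r : ℝ}
    (hr : r ∈ Set.Ioo (0 : ℝ) 1) : ‖charFunAt T r‖ ≤ 1 := by
  refine opNorm_le_bound _ zero_le_one fun f => ?_
  rw [one_mul]
  set u := charFunState T r f
  set w := fockMap n (adjoint T) u + fockMap n (fromDefect T) f with hw
  have huw : ‖u‖ ≤ ‖w‖ := by
    have : u = (r : ℂ) • rightRow n H w := charFunState_eq hT hr f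
    rw [this, norm_smul, norm_rightRow_apply, Complex.norm_real, Real.norm_of_nonneg hr.1.le]
    exact mul_le_of_le_one_left (norm_nonneg _) hr.2.le
  have h1 := (Fock.hasSum_norm_sq w).add (Fock.hasSum_norm_sq (charFunAt T r f))
  have h2 := (Fock.hasSum_norm_sq u).add (Fock.hasSum_norm_sq f)
  have e : (fun α => ‖w α‖ ^ 2 + ‖charFunAt T r f α‖ ^ 2) = fun α => ‖u α‖ ^ 2 + ‖f α‖ ^ 2 :=
    funext fun α => norm_sq_colligation hT (u α) (f α)
  rw [e] at h1
  have h3 := h1.unique h2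
  refine (sq_le_sq₀ (norm_nonneg _) (norm_nonneg _)).1 ?_
  have := pow_le_pow_left₀ (norm_nonneg _) huw 2
  linarith

lemma eventually_mem_Ioo_zero_one : ∀ᶠ r in 𝓝[<] (1 : ℝ), r ∈ Set.Ioo (0 : ℝ) 1 :=
  Ioo_mem_nhdsLT zero_lt_one

lemma tendsto_ofReal_nhdsLT_one : Tendsto (fun r : ℝ => (r : ℂ)) (𝓝[<] 1) (𝓝 1) :=
  tendsto_nhdsWithin_of_tendsto_nhds (by simpa using Complex.continuous_ofReal.tendsto 1)

/-- The vectors `(I - r R̃ T̃*)⁻¹ r R̃ D_{T̃} f` converge coefficientwise as `r → 1⁻`; the limit need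
not be square summable. -/
lemma exists_tendsto_charFunState {T : Copies n H →L[ℂ] H} (hT : ‖T‖ ≤ 1)
    (f : Fock n (defectSpace T)) :
    ∃ U : FreeMonoid (Fin n) → H,
      (∀ α, Tendsto (fun r => charFunState T r f α) (𝓝[<] 1) (𝓝 (U α))) ∧ U 1 = 0 ∧
      ∀ α j, U (α * FreeMonoid.of j) = (adjoint T (U α) + defectOp T (f α)) j := by
  -- A coefficient is reached in finitely many continuous steps, so the limit passes through the
  -- recursion without any summability.
  have hstep : ∀ α j x, Tendsto (fun r => charFunState T r f α) (𝓝[<] 1) (𝓝 x) →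
      Tendsto (fun r => charFunState T r f (α * FreeMonoid.of j)) (𝓝[<] 1)
        (𝓝 ((adjoint T x + defectOp T (f α)) j)) := by
    intro α j x hx
    have hc : Continuous fun y => (adjoint T y + defectOp T (f α)) j := by fun_prop
    have := tendsto_ofReal_nhdsLT_one.smul ((hc.tendsto x).comp hx)
    rw [one_smul] at this
    refine this.congr' ?_
    filter_upwards [eventually_mem_Ioo_zero_one] with r hr
    exact (charFunState_mul_of hT hr f α j).symm
  have hone : Tendsto (fun r => charFunState T r f 1) (𝓝[<] 1) (𝓝 0) := by
    refine tendsto_const_nhds.congr' ?_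
    filter_upwards [eventually_mem_Ioo_zero_one] with r hr
    exact (charFunState_one hT hr f).symm
  have hex : ∀ α, ∃ x, Tendsto (fun r => charFunState T r f α) (𝓝[<] 1) (𝓝 x) := by
    intro α
    induction α using freeMonoid_reverse_induction with
    | one => exact ⟨0, hone⟩
    | mul_of α j ih =>
      obtain ⟨x, hx⟩ := ih
      exact ⟨_, hstep α j x hx⟩
  choose U hU using hex
  exact ⟨U, hU, tendsto_nhds_unique (hU 1) hone,
    fun α j => tendsto_nhds_unique (hU _) (hstep α j _ (hU α))⟩

/-- Homogeneity: for an input supported at `γ`, each letter after `γ` costs one factor `r`, so the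
coefficient at `β` is `r ^ (|β| - |γ|)` times its limit `y β`. Multiplying by `r ^ |γ|` avoids
negative exponents and makes `Fock.tendsto_of_gauge` applicable. -/
lemma exists_tendsto_charFunAt_single [DecidableEq (FreeMonoid (Fin n))]
    {T : Copies n H →L[ℂ] H} (hT : ‖T‖ ≤ 1) (γ : FreeMonoid (Fin n)) (x : defectSpace T) :
    ∃ y, Tendsto (fun r : ℝ => charFunAt T r (lp.single 2 γ x)) (𝓝[<] 1) (𝓝 y) := by
  set f : Fock n (defectSpace T) := lp.single 2 γ x with hf
  obtain ⟨U, hU, hU1, hUs⟩ := exists_tendsto_charFunState hT f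
  set y : FreeMonoid (Fin n) → defectSpace (adjoint T) :=
    fun β => -defectRestrict T (f β) + toDefect (adjoint T) (U β) with hy
  -- Both sides vanish unless `β = γ`.
  have hfγ : ∀ β (r : ℂ), r ^ γ.length • (f β : Copies n H) = r ^ β.length • (f β : Copies n H) := by
    intro β r
    by_cases h : β = γ
    · rw [h]
    · simp [hf, h]
  have hstate : ∀ r ∈ Set.Ioo (0 : ℝ) 1, ∀ β,
      (r : ℂ) ^ γ.length • charFunState T r f β = (r : ℂ) ^ β.length • U β := by
    intro r hr β
    induction β using freeMonoid_reverse_induction with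
    | one => simp [hU1, charFunState_one hT hr]
    | mul_of β j ih =>
      rw [charFunState_mul_of hT hr, hUs, smul_comm, ← PiLp.smul_apply, smul_add, ← map_smul, ih,
        ← map_smul (defectOp T), hfγ, map_smul, map_smul, ← smul_add, PiLp.smul_apply, smul_smul,
        FreeMonoid.length_mul, FreeMonoid.length_of, pow_succ']
  have hout : ∀ r ∈ Set.Ioo (0 : ℝ) 1, ∀ β,
      (r : ℂ) ^ γ.length • charFunAt T r f β = (r : ℂ) ^ β.length • y β := by
    intro r hr β
    refine Subtype.ext ?_
    change (r : ℂ) ^ γ.length • (charFunAt T r f β : H) =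
      (r : ℂ) ^ β.length • (-T (f β : Copies n H) + defectOp (adjoint T) (U β))
    rw [charFunAt_apply_coe, smul_add, smul_add, smul_neg, smul_neg, ← map_smul, hfγ, ← map_smul,
      hstate r hr, map_smul, map_smul]
  have hlim : ∀ β, Tendsto (fun r => charFunAt T r f β) (𝓝[<] 1) (𝓝 (y β)) := by
    intro β
    exact tendsto_const_nhds.add (((toDefect (adjoint T)).continuous.tendsto _).comp (hU β))
  -- The family `y` is a coefficientwise limit of vectors of norm at most `‖f‖`, hence square
  -- summable.
  have hmem : Memℓp y 2 := by
    refine memℓp_gen' (C := ‖f‖ ^ (2 : ℝ≥0∞).toReal)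
      (lp.sum_rpow_le_of_tendsto (l := 𝓝[<] (1 : ℝ)) (F := fun r => charFunAt T r f) (by norm_num)
      ?_ (tendsto_pi_nhds.2 hlim))
    filter_upwards [eventually_mem_Ioo_zero_one] with r hr
    exact ((charFunAt T r).le_of_opNorm_le (norm_charFunAt_le hT hr) f).trans (one_mul _).le
  have hg := Fock.tendsto_of_gauge ⟨y, hmem⟩ (fun r => (r : ℂ) ^ γ.length • charFunAt T r f) (by
    filter_upwards [eventually_mem_Ioo_zero_one] with r hr β
    exact hout r hr β)
  -- The auxiliary factor `r ^ |γ|` tends to `1` and is divided out.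
  have hinv := ((tendsto_ofReal_nhdsLT_one.pow γ.length).inv₀ (by simp)).smul hg
  refine ⟨_, hinv.congr' ?_⟩
  filter_upwards [eventually_mem_Ioo_zero_one] with r hr
  rw [smul_smul, inv_mul_cancel₀, one_smul]
  exact pow_ne_zero _ (Complex.ofReal_ne_zero.2 hr.1.ne')

/-- The limit defining the characteristic function of a row contraction exists. -/
lemma exists_isCharFun {T : Copies n H →L[ℂ] H} (hT : IsRowContraction T) :
    ∃ Θ, IsCharFun T Θ := by
  classical
  have hex : ∀ f, ∃ y, Tendsto (fun r : ℝ => charFunAt T r f) (𝓝[<] 1) (𝓝 y) := by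
    intro f
    refine exists_tendsto_of_mem_closure
      (eventually_mem_Ioo_zero_one.mono fun r hr => norm_charFunAt_le hT hr) ?_
    refine mem_closure_of_tendsto (lp.hasSum_single (p := 2) (by norm_num) f)
      (Eventually.of_forall fun s => ?_)
    choose y hy using fun γ => exists_tendsto_charFunAt_single hT γ (f γ)
    refine ⟨∑ γ ∈ s, y γ, ?_⟩
    simp_rw [map_sum]
    exact tendsto_finsetSum s fun γ _ => hy γ
  choose Θ hΘ using hex
  -- The pointwise limit is bounded by Banach-Steinhaus.
  exact ⟨continuousLinearMapOfTendsto (charFunAt T) (tendsto_pi_nhds.2 hΘ), hΘ⟩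

lemma isCharFun_charFun {T : Copies n H →L[ℂ] H} (hT : IsRowContraction T) :
    IsCharFun T (charFun T) := by
  have h := exists_isCharFun hT
  rw [charFun, dif_pos h]
  exact h.choose_spec

/-- A recursive description of the coefficients of `Θ_T f`. -/
lemma exists_charFun_apply_eq {T : Copies n H →L[ℂ] H} (hT : IsRowContraction T)
    (f : Fock n (defectSpace T)) :
    ∃ U : FreeMonoid (Fin n) → H, U 1 = 0 ∧
      (∀ α j, U (α * FreeMonoid.of j) = (adjoint T (U α) + defectOp T (f α)) j) ∧
      ∀ α, (charFun T f α : H) = -T (f α : Copies n H) + defectOp (adjoint T) (U α) := by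
  obtain ⟨U, hU, hU1, hUs⟩ := exists_tendsto_charFunState hT f
  refine ⟨U, hU1, hUs, fun α => ?_⟩
  have h1 : Tendsto (fun r => charFunAt T r f α) (𝓝[<] 1) (𝓝 (charFun T f α)) :=
    ((continuous_apply α).comp lp.uniformContinuous_coe.continuous).continuousAt.tendsto.comp
      (isCharFun_charFun hT f)
  have h2 : Tendsto (fun r => (charFunAt T r f α : H)) (𝓝[<] 1)
      (𝓝 (-T (f α : Copies n H) + defectOp (adjoint T) (U α))) := by
    simp_rw [charFunAt_apply_coe]
    exact tendsto_const_nhds.add (((defectOp (adjoint T)).continuous.tendsto _).comp (hU α))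
  exact tendsto_nhds_unique ((continuous_subtype_val.tendsto _).comp h1) h2

end Characteristic

/-! ### Unitaries determined on dense ranges. -/

section Hilbert

variable {E G₁ G₂ : Type*}
  [NormedAddCommGroup E] [InnerProductSpace ℂ E]
  [NormedAddCommGroup G₁] [InnerProductSpace ℂ G₁]
  [NormedAddCommGroup G₂] [InnerProductSpace ℂ G₂]

/-- The assignment `D x ↦ M x` is isometric between dense subspaces, so it extends to the complete
spaces; density of the range of `D` gives uniqueness. -/
lemma existsUnique_isometryEquiv [CompleteSpace G₁] [CompleteSpace G₂] (D : E →L[ℂ] G₁)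
    (M : E →L[ℂ] G₂) (hD : DenseRange D) (hM : DenseRange M) (h : ∀ x, ‖M x‖ = ‖D x‖) :
    ∃! σ : G₁ ≃ₗᵢ[ℂ] G₂, ∀ x, σ (D x) = M x := by
  refine ⟨(LinearEquiv.refl ℂ E).extendOfIsometry (D : E →ₗ[ℂ] G₁) (M : E →ₗ[ℂ] G₂) hD hM h,
    fun x => LinearEquiv.extendOfIsometry_eq (LinearEquiv.refl ℂ E) (D : E →ₗ[ℂ] G₁)
      (M : E →ₗ[ℂ] G₂) hD hM h x, fun τ hτ => ?_⟩
  refine LinearIsometryEquiv.ext fun y => ?_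
  refine congrFun (hD.equalizer τ.continuous (LinearIsometryEquiv.continuous _)
    (funext fun x => ?_)) y
  exact (hτ x).trans (LinearEquiv.extendOfIsometry_eq (LinearEquiv.refl ℂ E) (D : E →ₗ[ℂ] G₁)
      (M : E →ₗ[ℂ] G₂) hD hM h x).symm

@[simp] lemma inlOp_fst (x : G₁) : (inlOp G₁ G₂ x).fst = x := rfl
@[simp] lemma inlOp_snd (x : G₁) : (inlOp G₁ G₂ x).snd = 0 := rfl
@[simp] lemma inrOp_fst (x : G₂) : (inrOp G₁ G₂ x).fst = 0 := rfl
@[simp] lemma inrOp_snd (x : G₂) : (inrOp G₁ G₂ x).snd = x := rfl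

/-- The closure of the range contains the first summand by `h₁`. Modulo that summand, `h₂` supplies
a dense part of the second. -/
lemma denseRange_of_triangular {X Y : Type*} {p : X → G₁} {q : Y → G₂} (hp : DenseRange p)
    (hq : DenseRange q) (M : E →L[ℂ] WithLp 2 (G₁ × G₂))
    (h₁ : ∀ x, ∃ e, (M e).fst = p x ∧ (M e).snd = 0) (h₂ : ∀ y, ∃ e, (M e).snd = q y) :
    DenseRange M := by
  let K := (LinearMap.range (M : E →ₗ[ℂ] WithLp 2 (G₁ × G₂))).topologicalClosure
  have hK : IsClosed (K : Set (WithLp 2 (G₁ × G₂))) := Submodule.isClosed_topologicalClosure _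
  have hM : ∀ e, M e ∈ K := fun e => Submodule.le_topologicalClosure _ ⟨e, rfl⟩
  have hl : ∀ a, inlOp G₁ G₂ a ∈ K := fun a => by
    refine hp.induction_on (p := fun a => inlOp G₁ G₂ a ∈ K) a
      (hK.preimage (inlOp G₁ G₂).continuous) fun x => ?_
    obtain ⟨e, he₁, he₂⟩ := h₁ x
    have : inlOp G₁ G₂ (p x) = M e := WithLp.ofLp_injective 2 (Prod.ext he₁.symm he₂.symm)
    rw [this]
    exact hM e
  have hr : ∀ b, inrOp G₁ G₂ b ∈ K := fun b => by
    refine hq.induction_on (p := fun b => inrOp G₁ G₂ b ∈ K) b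
      (hK.preimage (inrOp G₁ G₂).continuous) fun y => ?_
    obtain ⟨e, he⟩ := h₂ y
    have : inrOp G₁ G₂ (q y) = M e - inlOp G₁ G₂ (M e).fst := by
      refine WithLp.ofLp_injective 2 (Prod.ext ?_ ?_)
      · exact (sub_self _).symm
      · exact he.symm.trans (sub_zero _).symm
    rw [this]
    exact K.sub_mem (hM e) (hl _)
  intro z
  have hz : z = inlOp G₁ G₂ z.fst + inrOp G₁ G₂ z.snd :=
    WithLp.ofLp_injective 2 (Prod.ext (add_zero _).symm (zero_add _).symm)
  rw [hz]
  exact K.add_mem (hl _) (hr _)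

end Hilbert

section Shuffle

variable {n : ℕ} {E₁ E₂ : Type*}
  [NormedAddCommGroup E₁] [InnerProductSpace ℂ E₁]
  [NormedAddCommGroup E₂] [InnerProductSpace ℂ E₂]

/-- The canonical identification `(⊕ⁿ E₁) ⊕ (⊕ⁿ E₂) → ⊕ⁿ (E₁ ⊕ E₂)`. -/
def unshuffle (a : Copies n E₁) (b : Copies n E₂) : Copies n (WithLp 2 (E₁ × E₂)) :=
  WithLp.toLp 2 fun j => WithLp.toLp 2 (a j, b j)

@[simp] lemma shuffle_unshuffle_fst (a : Copies n E₁) (b : Copies n E₂) :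
    (shuffle n E₁ E₂ (unshuffle a b)).fst = a := rfl

@[simp] lemma shuffle_unshuffle_snd (a : Copies n E₁) (b : Copies n E₂) :
    (shuffle n E₁ E₂ (unshuffle a b)).snd = b := rfl

lemma inner_eq_shuffle (h k : Copies n (WithLp 2 (E₁ × E₂))) :
    (inner ℂ h k : ℂ) = inner ℂ (shuffle n E₁ E₂ h).fst (shuffle n E₁ E₂ k).fst +
      inner ℂ (shuffle n E₁ E₂ h).snd (shuffle n E₁ E₂ k).snd := by
  simp only [PiLp.inner_apply, shuffle_fst_apply, shuffle_snd_apply, ← Finset.sum_add_distrib]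
  rfl

lemma norm_sq_eq_shuffle (h : Copies n (WithLp 2 (E₁ × E₂))) :
    ‖h‖ ^ 2 = ‖(shuffle n E₁ E₂ h).fst‖ ^ 2 + ‖(shuffle n E₁ E₂ h).snd‖ ^ 2 := by
  have := inner_eq_shuffle h h
  simp only [inner_self_eq_norm_sq_to_K] at this
  exact_mod_cast this

end Shuffle

/-- A contraction `T : E → F` together with its defect operators, which map densely into spaces `D`
and `D'`, and its restriction `τ` to these; `Ts`, `ε`, `ε'` and `τs` are the adjoints of `T`, `δ`,
`δ'` and `τ`. -/
structure DefectModel (E F D D' : Type*)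
    [NormedAddCommGroup E] [InnerProductSpace ℂ E]
    [NormedAddCommGroup F] [InnerProductSpace ℂ F]
    [NormedAddCommGroup D] [InnerProductSpace ℂ D]
    [NormedAddCommGroup D'] [InnerProductSpace ℂ D'] where
  T : E →L[ℂ] F
  Ts : F →L[ℂ] E
  δ : E →L[ℂ] D
  ε : D →L[ℂ] E
  δ' : F →L[ℂ] D'
  ε' : D' →L[ℂ] F
  τ : D →L[ℂ] D'
  τs : D' →L[ℂ] D
  inner_T : ∀ x y, inner ℂ (T x) y = inner ℂ x (Ts y)
  inner_ε : ∀ d x, inner ℂ (ε d) x = inner ℂ d (δ x)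
  inner_ε' : ∀ d x, inner ℂ (ε' d) x = inner ℂ d (δ' x)
  inner_τ : ∀ d d', inner ℂ (τ d) d' = inner ℂ d (τs d')
  ε_δ : ∀ x, ε (δ x) = x - Ts (T x)
  ε'_δ' : ∀ y, ε' (δ' y) = y - T (Ts y)
  τ_δ : ∀ x, τ (δ x) = δ' (T x)
  τs_δ' : ∀ y, τs (δ' y) = δ (Ts y)
  dense_δ : DenseRange δ
  dense_δ' : DenseRange δ'

/-! ### Algebra of defect models. -/

namespace DefectModel

section Basic

variable {E F D D' : Type*}
    [NormedAddCommGroup E] [InnerProductSpace ℂ E]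
    [NormedAddCommGroup F] [InnerProductSpace ℂ F]
    [NormedAddCommGroup D] [InnerProductSpace ℂ D]
    [NormedAddCommGroup D'] [InnerProductSpace ℂ D']
    (X : DefectModel E F D D')

lemma inner_Ts (y : F) (x : E) : inner ℂ (X.Ts y) x = inner ℂ y (X.T x) := by
  rw [← inner_conj_symm, ← X.inner_T, inner_conj_symm]

lemma inner_δ (x : E) (d : D) : inner ℂ (X.δ x) d = inner ℂ x (X.ε d) := by
  rw [← inner_conj_symm, ← X.inner_ε, inner_conj_symm]

lemma inner_δ' (x : F) (d : D') : inner ℂ (X.δ' x) d = inner ℂ x (X.ε' d) := by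
  rw [← inner_conj_symm, ← X.inner_ε', inner_conj_symm]

lemma inner_τs (d' : D') (d : D) : inner ℂ (X.τs d') d = inner ℂ d' (X.τ d) := by
  rw [← inner_conj_symm, ← X.inner_τ, inner_conj_symm]

/-- The model of the adjoint. -/
def symm : DefectModel F E D' D where
  T := X.Ts
  Ts := X.T
  δ := X.δ'
  ε := X.ε'
  δ' := X.δ
  ε' := X.ε
  τ := X.τs
  τs := X.τ
  inner_T := X.inner_Ts
  inner_ε := X.inner_ε'
  inner_ε' := X.inner_ε
  inner_τ := X.inner_τs
  ε_δ := X.ε'_δ'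
  ε'_δ' := X.ε_δ
  τ_δ := X.τs_δ'
  τs_δ' := X.τ_δ
  dense_δ := X.dense_δ'
  dense_δ' := X.dense_δ

/-- This is the adjoint of the relation `τs_δ'`. -/
lemma T_ε (d : D) : X.T (X.ε d) = X.ε' (X.τ d) :=
  ext_inner_right ℂ fun y => by
    rw [X.inner_T, X.inner_ε, X.inner_ε', X.inner_τ, X.τs_δ']

lemma Ts_ε' (d : D') : X.Ts (X.ε' d) = X.ε (X.τs d) := X.symm.T_ε d

/-- On the dense range of `δ` this is `ε_δ` combined with the two intertwining relations; both sides
are continuous. -/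
lemma δ_ε (d : D) : X.δ (X.ε d) = d - X.τs (X.τ d) := by
  refine X.dense_δ.induction_on (p := fun d => X.δ (X.ε d) = d - X.τs (X.τ d)) d
    (isClosed_eq (by fun_prop) (by fun_prop)) fun x => ?_
  rw [X.ε_δ, map_sub, X.τ_δ, X.τs_δ']

lemma δ'_ε' (d : D') : X.δ' (X.ε' d) = d - X.τ (X.τs d) := X.symm.δ_ε d

lemma norm_sq_δ (x : E) : ‖X.δ x‖ ^ 2 = ‖x‖ ^ 2 - ‖X.T x‖ ^ 2 := by
  have h : (inner ℂ (X.δ x) (X.δ x) : ℂ) = inner ℂ x x - inner ℂ (X.T x) (X.T x) := by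
    rw [X.inner_δ, X.ε_δ, inner_sub_right, X.inner_T]
  simp only [inner_self_eq_norm_sq_to_K] at h
  exact_mod_cast h

/-- The colligation of a contraction is isometric. -/
lemma norm_sq_add_norm_sq (u : F) (d : D) :
    ‖X.Ts u + X.ε d‖ ^ 2 + ‖-X.τ d + X.δ' u‖ ^ 2 = ‖u‖ ^ 2 + ‖d‖ ^ 2 := by
  have h : (inner ℂ (X.Ts u + X.ε d) (X.Ts u + X.ε d) +
      inner ℂ (-X.τ d + X.δ' u) (-X.τ d + X.δ' u) : ℂ) = inner ℂ u u + inner ℂ d d := by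
    simp only [inner_add_left, inner_add_right, inner_neg_left, inner_neg_right, X.inner_Ts,
      X.inner_ε, X.inner_τ, X.inner_δ', X.δ_ε, X.T_ε, X.ε'_δ', X.τs_δ', inner_sub_right]
    ring
  simp only [inner_self_eq_norm_sq_to_K] at h
  exact_mod_cast h

end Basic

/-! ### The unitaries `σ` and `σ_*` of a triangular contraction. -/

section Triangular

variable {n : ℕ} {H₁ H₂ DA DA' DB DB' DL DL' DT DT' : Type*}
  [NormedAddCommGroup H₁] [InnerProductSpace ℂ H₁]
  [NormedAddCommGroup H₂] [InnerProductSpace ℂ H₂]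
  [NormedAddCommGroup DA] [InnerProductSpace ℂ DA]
  [NormedAddCommGroup DA'] [InnerProductSpace ℂ DA']
  [NormedAddCommGroup DB] [InnerProductSpace ℂ DB]
  [NormedAddCommGroup DB'] [InnerProductSpace ℂ DB']
  [NormedAddCommGroup DL] [InnerProductSpace ℂ DL]
  [NormedAddCommGroup DL'] [InnerProductSpace ℂ DL']
  [NormedAddCommGroup DT] [InnerProductSpace ℂ DT]
  [NormedAddCommGroup DT'] [InnerProductSpace ℂ DT']
  (A : DefectModel (Copies n H₁) H₁ DA DA') (B : DefectModel (Copies n H₂) H₂ DB DB')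
  (L : DefectModel DB DA' DL DL')

/-- `W` is a model of `[[A, D_{A*} L D_B], [0, B]]`. -/
def IsTriangular
    (W : DefectModel (Copies n (WithLp 2 (H₁ × H₂))) (WithLp 2 (H₁ × H₂)) DT DT') : Prop :=
  W.T = blockOp A.T (A.ε' ∘L L.T ∘L B.δ) 0 B.T ∘L shuffle n H₁ H₂

/-- The operator `[[D_A, -A* L D_B], [0, D_L D_B]]` into `𝓓_A ⊕ 𝓓_L`. -/
noncomputable def sigmaMap : Copies n (WithLp 2 (H₁ × H₂)) →L[ℂ] WithLp 2 (DA × DL) :=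
  blockOp A.δ (-(A.τs ∘L L.T ∘L B.δ)) 0 (L.δ ∘L B.δ) ∘L shuffle n H₁ H₂

lemma sigmaMap_fst (h : Copies n (WithLp 2 (H₁ × H₂))) :
    (sigmaMap A B L h).fst = A.δ (shuffle n H₁ H₂ h).fst -
      A.τs (L.T (B.δ (shuffle n H₁ H₂ h).snd)) :=
  (sub_eq_add_neg _ _).symm

lemma sigmaMap_snd (h : Copies n (WithLp 2 (H₁ × H₂))) :
    (sigmaMap A B L h).snd = L.δ (B.δ (shuffle n H₁ H₂ h).snd) := zero_add _

/-- The operator `[[-B L* D_{A*}, D_{B*}], [D_{L*} D_{A*}, 0]]` into `𝓓_{B*} ⊕ 𝓓_{L*}`. -/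
noncomputable def sigmaStarMap : WithLp 2 (H₁ × H₂) →L[ℂ] WithLp 2 (DB' × DL') :=
  blockOp (-(B.τ ∘L L.Ts ∘L A.δ')) B.δ' (L.δ' ∘L A.δ') 0

lemma sigmaStarMap_fst (u : WithLp 2 (H₁ × H₂)) :
    (sigmaStarMap A B L u).fst = -B.τ (L.Ts (A.δ' u.fst)) + B.δ' u.snd := rfl

lemma sigmaStarMap_snd (u : WithLp 2 (H₁ × H₂)) :
    (sigmaStarMap A B L u).snd = L.δ' (A.δ' u.fst) := add_zero _

lemma denseRange_sigmaMap : DenseRange (sigmaMap A B L) := by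
  refine denseRange_of_triangular A.dense_δ (L.dense_δ.comp B.dense_δ L.δ.continuous) _
    (fun x => ⟨unshuffle x 0, ?_, ?_⟩) fun y => ⟨unshuffle 0 y, ?_⟩
  · simp [sigmaMap_fst]
  · simp [sigmaMap_snd]
  · simp [sigmaMap_snd]

/-- The matrix becomes triangular once the summands `H₁` and `H₂` are exchanged. -/
lemma denseRange_sigmaStarMap : DenseRange (sigmaStarMap A B L) := by
  refine denseRange_of_triangular B.dense_δ' (L.dense_δ'.comp A.dense_δ' L.δ'.continuous) _
    (fun x => ⟨inrOp H₁ H₂ x, ?_, ?_⟩) fun y => ⟨inlOp H₁ H₂ y, ?_⟩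
  · simp [sigmaStarMap_fst]
  · simp [sigmaStarMap_snd]
  · simp [sigmaStarMap_snd]

variable {A B L}
  {W : DefectModel (Copies n (WithLp 2 (H₁ × H₂))) (WithLp 2 (H₁ × H₂)) DT DT'}
  (hW : IsTriangular A B L W)

include hW

lemma IsTriangular.T_fst (h : Copies n (WithLp 2 (H₁ × H₂))) :
    (W.T h).fst = A.T (shuffle n H₁ H₂ h).fst +
      A.ε' (L.T (B.δ (shuffle n H₁ H₂ h).snd)) := by
  unfold IsTriangular at hW
  rw [hW]
  rfl

lemma IsTriangular.T_snd (h : Copies n (WithLp 2 (H₁ × H₂))) :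
    (W.T h).snd = B.T (shuffle n H₁ H₂ h).snd := by
  unfold IsTriangular at hW
  rw [hW]
  exact zero_add _

lemma IsTriangular.Ts_apply (u : WithLp 2 (H₁ × H₂)) :
    W.Ts u = unshuffle (A.Ts u.fst) (B.ε (L.Ts (A.δ' u.fst)) + B.Ts u.snd) := by
  refine ext_inner_right ℂ fun h => (W.inner_Ts u h).trans ?_
  refine Eq.trans ?_ (inner_eq_shuffle (unshuffle _ _) h).symm
  refine (WithLp.prod_inner_apply u (W.T h)).trans ?_
  have e₁ : (inner ℂ u.fst (W.T h).fst : ℂ) =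
      inner ℂ (A.Ts u.fst) (shuffle n H₁ H₂ h).fst +
      inner ℂ (B.ε (L.Ts (A.δ' u.fst))) (shuffle n H₁ H₂ h).snd := by
    rw [hW.T_fst, inner_add_right, A.inner_Ts, B.inner_ε, L.inner_Ts, A.inner_δ']
  have e₂ : (inner ℂ u.snd (W.T h).snd : ℂ) =
      inner ℂ (B.Ts u.snd) (shuffle n H₁ H₂ h).snd := by
    rw [hW.T_snd, B.inner_Ts]
  refine (congrArg₂ (· + ·) e₁ e₂).trans ?_
  rw [shuffle_unshuffle_fst, shuffle_unshuffle_snd, inner_add_left, add_assoc]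

/-- The colligation of `A*`, applied to `h₁` and `L D_B h₂`, turns the entries involving `A` into
`‖h₁‖² + ‖L D_B h₂‖²`. Adding `‖D_L D_B h₂‖²` leaves `‖D_B h₂‖² = ‖h₂‖² - ‖B h₂‖²`, and the total is
`‖h‖² - ‖T h‖²`. -/
lemma IsTriangular.norm_sigmaMap (h : Copies n (WithLp 2 (H₁ × H₂))) :
    ‖sigmaMap A B L h‖ = ‖W.δ h‖ := by
  refine (sq_eq_sq₀ (norm_nonneg _) (norm_nonneg _)).1 ?_
  set h₁ := (shuffle n H₁ H₂ h).fst with hh₁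
  set h₂ := (shuffle n H₁ H₂ h).snd with hh₂
  have e₀ : ‖sigmaMap A B L h‖ ^ 2 =
      ‖-A.τs (L.T (B.δ h₂)) + A.δ h₁‖ ^ 2 + ‖L.δ (B.δ h₂)‖ ^ 2 := by
    refine (WithLp.prod_norm_sq_eq_of_L2 (sigmaMap A B L h)).trans ?_
    refine congrArg₂ (· + ·) (congrArg (‖·‖ ^ 2) ?_) (congrArg (‖·‖ ^ 2) (sigmaMap_snd A B L h))
    exact (sigmaMap_fst A B L h).trans (by rw [neg_add_eq_sub])
  have e₁ : ‖W.T h‖ ^ 2 = ‖A.T h₁ + A.ε' (L.T (B.δ h₂))‖ ^ 2 + ‖B.T h₂‖ ^ 2 := by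
    refine (WithLp.prod_norm_sq_eq_of_L2 (W.T h)).trans ?_
    exact congrArg₂ (· + ·) (congrArg (‖·‖ ^ 2) (hW.T_fst h)) (congrArg (‖·‖ ^ 2) (hW.T_snd h))
  have key : ‖A.T h₁ + A.ε' (L.T (B.δ h₂))‖ ^ 2 + ‖-A.τs (L.T (B.δ h₂)) + A.δ h₁‖ ^ 2 =
    ‖h₁‖ ^ 2 + ‖L.T (B.δ h₂)‖ ^ 2 := A.symm.norm_sq_add_norm_sq h₁ (L.T (B.δ h₂))
  have e₃ := L.norm_sq_δ (B.δ h₂)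
  have e₄ := B.norm_sq_δ h₂
  have e₅ := W.norm_sq_δ h
  have e₆ := norm_sq_eq_shuffle h
  linarith

/-- The same balance, with the colligation of `B` applied to `u₂` and `L* D_{A*} u₁`. -/
lemma IsTriangular.norm_sigmaStarMap (u : WithLp 2 (H₁ × H₂)) :
    ‖sigmaStarMap A B L u‖ = ‖W.δ' u‖ := by
  refine (sq_eq_sq₀ (norm_nonneg _) (norm_nonneg _)).1 ?_
  set b := L.Ts (A.δ' u.fst) with hb
  have e₀ : ‖sigmaStarMap A B L u‖ ^ 2 =
      ‖-B.τ b + B.δ' u.snd‖ ^ 2 + ‖L.δ' (A.δ' u.fst)‖ ^ 2 := by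
    refine (WithLp.prod_norm_sq_eq_of_L2 (sigmaStarMap A B L u)).trans ?_
    exact congrArg₂ (· + ·) (congrArg (‖·‖ ^ 2) (sigmaStarMap_fst A B L u))
      (congrArg (‖·‖ ^ 2) (sigmaStarMap_snd A B L u))
  have e₁ : ‖W.Ts u‖ ^ 2 = ‖A.Ts u.fst‖ ^ 2 + ‖B.Ts u.snd + B.ε b‖ ^ 2 := by
    rw [hW.Ts_apply, add_comm (B.Ts u.snd)]
    exact norm_sq_eq_shuffle _
  have key := B.norm_sq_add_norm_sq u.snd b
  have e₃ : ‖L.δ' (A.δ' u.fst)‖ ^ 2 = ‖A.δ' u.fst‖ ^ 2 - ‖b‖ ^ 2 := L.symm.norm_sq_δ _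
  have e₄ : ‖A.δ' u.fst‖ ^ 2 = ‖u.fst‖ ^ 2 - ‖A.Ts u.fst‖ ^ 2 := A.symm.norm_sq_δ _
  have e₅ : ‖W.δ' u‖ ^ 2 = ‖u‖ ^ 2 - ‖W.Ts u‖ ^ 2 := W.symm.norm_sq_δ u
  have e₆ : ‖u‖ ^ 2 = ‖u.fst‖ ^ 2 + ‖u.snd‖ ^ 2 := WithLp.prod_norm_sq_eq_of_L2 u
  linarith

lemma IsTriangular.existsUnique_sigma [CompleteSpace DA] [CompleteSpace DL] [CompleteSpace DT] :
    ∃! σ : DT ≃ₗᵢ[ℂ] WithLp 2 (DA × DL), ∀ h, σ (W.δ h) = sigmaMap A B L h :=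
  existsUnique_isometryEquiv _ _ W.dense_δ (denseRange_sigmaMap A B L) hW.norm_sigmaMap

lemma IsTriangular.existsUnique_sigmaStar
    [CompleteSpace DB'] [CompleteSpace DL'] [CompleteSpace DT'] :
    ∃! σ' : DT' ≃ₗᵢ[ℂ] WithLp 2 (DB' × DL'), ∀ u, σ' (W.δ' u) = sigmaStarMap A B L u :=
  existsUnique_isometryEquiv _ _ W.dense_δ' (denseRange_sigmaStarMap A B L) hW.norm_sigmaStarMap

end Triangular

end DefectModel

namespace DefectModel

/-! ### The colligation of `T` as a cascade, and the factorization. -/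

section Factorization

variable {n : ℕ} {H₁ H₂ DA DA' DB DB' DL DL' DT DT' : Type*}
  [NormedAddCommGroup H₁] [InnerProductSpace ℂ H₁]
  [NormedAddCommGroup H₂] [InnerProductSpace ℂ H₂]
  [NormedAddCommGroup DA] [InnerProductSpace ℂ DA]
  [NormedAddCommGroup DA'] [InnerProductSpace ℂ DA']
  [NormedAddCommGroup DB] [InnerProductSpace ℂ DB]
  [NormedAddCommGroup DB'] [InnerProductSpace ℂ DB']
  [NormedAddCommGroup DL] [InnerProductSpace ℂ DL]
  [NormedAddCommGroup DL'] [InnerProductSpace ℂ DL']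
  [NormedAddCommGroup DT] [InnerProductSpace ℂ DT]
  [NormedAddCommGroup DT'] [InnerProductSpace ℂ DT']
  {A : DefectModel (Copies n H₁) H₁ DA DA'} {B : DefectModel (Copies n H₂) H₂ DB DB'}
  {L : DefectModel DB DA' DL DL'}
  {W : DefectModel (Copies n (WithLp 2 (H₁ × H₂))) (WithLp 2 (H₁ × H₂)) DT DT'}

/-- The Julia-Halmos matrix `[[L*, D_L], [D_{L*}, -L]]`. -/
noncomputable def julia (L : DefectModel DB DA' DL DL') :
    WithLp 2 (DA' × DL) →L[ℂ] WithLp 2 (DB × DL') :=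
  blockOp L.Ts L.ε L.δ' (-L.τ)

/-- `Θ` is the transfer function of the colligation `[[T*, D_T], [D_{T*}, -T]]`, described through
the coefficients of its values. -/
def IsTransfer {H D D' : Type*}
    [NormedAddCommGroup H] [InnerProductSpace ℂ H] [NormedAddCommGroup D] [InnerProductSpace ℂ D]
    [NormedAddCommGroup D'] [InnerProductSpace ℂ D'] (X : DefectModel (Copies n H) H D D')
    (Θ : Fock n D →L[ℂ] Fock n D') : Prop :=
  ∀ f, ∃ U : FreeMonoid (Fin n) → H, U 1 = 0 ∧
    (∀ α j, U (α * FreeMonoid.of j) = (X.Ts (U α) + X.ε (f α)) j) ∧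
    ∀ α, Θ f α = -X.τ (f α) + X.δ' (U α)

section Pointwise

variable (hW : IsTriangular A B L W) {σ : DT ≃ₗᵢ[ℂ] WithLp 2 (DA × DL)}
  (hσ : ∀ h, σ (W.δ h) = sigmaMap A B L h) {σ' : DT' ≃ₗᵢ[ℂ] WithLp 2 (DB' × DL')}
  (hσ' : ∀ u, σ' (W.δ' u) = sigmaStarMap A B L u)

include hW

/-- Writing `A A* = I - D_{A*}²` recovers the first component `A h₁ + D_{A*} L D_B h₂` of `T h`
under `D_{A*}`. -/
lemma τ_sigmaMap_fst (h : Copies n (WithLp 2 (H₁ × H₂))) :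
    A.τ (sigmaMap A B L h).fst = A.δ' (W.T h).fst - L.T (B.δ (shuffle n H₁ H₂ h).snd) := by
  rw [sigmaMap_fst, map_sub, A.τ_δ, hW.T_fst, map_add, A.δ'_ε']
  abel

/-- `L* L + D_L² = I` collapses the terms in `D_B h₂`. -/
lemma julia_sigmaMap_fst (h : Copies n (WithLp 2 (H₁ × H₂))) :
    L.Ts (-A.τ (sigmaMap A B L h).fst) + L.ε (sigmaMap A B L h).snd =
      B.δ (shuffle n H₁ H₂ h).snd - L.Ts (A.δ' (W.T h).fst) := by
  rw [τ_sigmaMap_fst hW, sigmaMap_snd, L.ε_δ, neg_sub, map_sub]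
  abel

/-- `D_{L*} L = L D_L` cancels the terms in `D_B h₂`. -/
lemma julia_sigmaMap_snd (h : Copies n (WithLp 2 (H₁ × H₂))) :
    L.δ' (-A.τ (sigmaMap A B L h).fst) - L.τ (sigmaMap A B L h).snd =
      -L.δ' (A.δ' (W.T h).fst) := by
  rw [τ_sigmaMap_fst hW, sigmaMap_snd, L.τ_δ, neg_sub, map_sub]
  abel

include hσ

/-- The input entry `D_T` of the colligation is that of the cascade. For `x = D_T h` the left side
is `h - T* T h`, which the preceding identities match; density does the rest. -/
lemma ε_eq (x : DT) :
    W.ε x = unshuffle (A.ε (σ x).fst)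
      (B.ε (L.Ts (-A.τ (σ x).fst) + L.ε (σ x).snd)) := by
  have hfst : (shuffle n H₁ H₂ (W.ε x)).fst = A.ε (σ x).fst := by
    refine W.dense_δ.induction_on (p := fun x =>
      (shuffle n H₁ H₂ (W.ε x)).fst = A.ε (σ x).fst) x
      (isClosed_eq (by fun_prop) (by fun_prop)) fun h => ?_
    rw [hσ, W.ε_δ, hW.Ts_apply, map_sub, WithLp.sub_fst, shuffle_unshuffle_fst, sigmaMap_fst,
      hW.T_fst, map_sub A.ε, A.ε_δ, map_add, A.Ts_ε']
    abel
  have hsnd : (shuffle n H₁ H₂ (W.ε x)).snd =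
      B.ε (L.Ts (-A.τ (σ x).fst) + L.ε (σ x).snd) := by
    refine W.dense_δ.induction_on (p := fun x => (shuffle n H₁ H₂ (W.ε x)).snd =
      B.ε (L.Ts (-A.τ (σ x).fst) + L.ε (σ x).snd)) x
      (isClosed_eq (by fun_prop) (by fun_prop)) fun h => ?_
    rw [hσ, W.ε_δ, hW.Ts_apply, map_sub, WithLp.sub_snd, shuffle_unshuffle_snd,
      julia_sigmaMap_fst hW, map_sub B.ε, B.ε_δ, hW.T_snd]
    abel
  rw [← hfst, ← hsnd]
  rfl

include hσ'

/-- Since `T D_T = D_{T*} T`, on the dense range of `D_T` the formula for `σ_*` is applied to `T h`.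
-/
lemma sigmaStar_τ_fst (x : DT) :
    (σ' (-W.τ x)).fst = -B.τ (L.Ts (-A.τ (σ x).fst) + L.ε (σ x).snd) := by
  refine W.dense_δ.induction_on (p := fun x =>
    (σ' (-W.τ x)).fst = -B.τ (L.Ts (-A.τ (σ x).fst) + L.ε (σ x).snd)) x
    (isClosed_eq (by fun_prop) (by fun_prop)) fun h => ?_
  rw [hσ, W.τ_δ, map_neg, hσ', WithLp.neg_fst, julia_sigmaMap_fst hW, sigmaStarMap_fst,
    map_sub, B.τ_δ, hW.T_snd]
  abel

lemma sigmaStar_τ_snd (x : DT) :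
    (σ' (-W.τ x)).snd = L.δ' (-A.τ (σ x).fst) - L.τ (σ x).snd := by
  refine W.dense_δ.induction_on (p := fun x =>
    (σ' (-W.τ x)).snd = L.δ' (-A.τ (σ x).fst) - L.τ (σ x).snd) x
    (isClosed_eq (by fun_prop) (by fun_prop)) fun h => ?_
  rw [hσ, W.τ_δ, map_neg, hσ', WithLp.neg_snd, julia_sigmaMap_snd hW, sigmaStarMap_snd]

end Pointwise

lemma fockDiag_apply_fst {E₁ E₂ F₁ F₂ : Type*}
    [NormedAddCommGroup E₁] [InnerProductSpace ℂ E₁]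
    [NormedAddCommGroup E₂] [InnerProductSpace ℂ E₂]
    [NormedAddCommGroup F₁] [InnerProductSpace ℂ F₁]
    [NormedAddCommGroup F₂] [InnerProductSpace ℂ F₂]
    (M : Fock n E₁ →L[ℂ] Fock n F₁) (N : Fock n E₂ →L[ℂ] Fock n F₂)
    (f : Fock n (WithLp 2 (E₁ × E₂))) (α : FreeMonoid (Fin n)) :
    (fockDiag M N f α).fst = M (fockMap n (WithLp.fstL 2 ℂ E₁ E₂) f) α :=
  add_zero _

lemma fockDiag_id_apply_snd {E₁ E₂ F₁ : Type*}
    [NormedAddCommGroup E₁] [InnerProductSpace ℂ E₁]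
    [NormedAddCommGroup E₂] [InnerProductSpace ℂ E₂]
    [NormedAddCommGroup F₁] [InnerProductSpace ℂ F₁]
    (M : Fock n E₁ →L[ℂ] Fock n F₁)
    (f : Fock n (WithLp 2 (E₁ × E₂))) (α : FreeMonoid (Fin n)) :
    (fockDiag M (ContinuousLinearMap.id ℂ (Fock n E₂)) f α).snd = (f α).snd :=
  zero_add _

/-- The transfer function of a triangular operator is that of the cascade of `A` and `B`. -/
theorem IsTriangular.transfer_eq (hW : IsTriangular A B L W) {σ : DT ≃ₗᵢ[ℂ] WithLp 2 (DA × DL)}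
    (hσ : ∀ h, σ (W.δ h) = sigmaMap A B L h) {σ' : DT' ≃ₗᵢ[ℂ] WithLp 2 (DB' × DL')}
    (hσ' : ∀ u, σ' (W.δ' u) = sigmaStarMap A B L u)
    {ΘA : Fock n DA →L[ℂ] Fock n DA'} {ΘB : Fock n DB →L[ℂ] Fock n DB'}
    {ΘT : Fock n DT →L[ℂ] Fock n DT'}
    (hA : IsTransfer A ΘA) (hB : IsTransfer B ΘB) (hT : IsTransfer W ΘT) :
    ΘT = fockMap n (σ'.symm : WithLp 2 (DB' × DL') →L[ℂ] DT') ∘L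
      fockDiag ΘB (ContinuousLinearMap.id ℂ (Fock n DL')) ∘L fockMap n (julia L) ∘L
        fockDiag ΘA (ContinuousLinearMap.id ℂ (Fock n DL)) ∘L
          fockMap n (σ : DT →L[ℂ] WithLp 2 (DA × DL)) := by
  refine ContinuousLinearMap.ext fun f => lp.ext (funext fun α => ?_)
  set g₁ : Fock n (WithLp 2 (DA × DL)) := fockMap n (σ : DT →L[ℂ] WithLp 2 (DA × DL)) f
  set g₂ : Fock n (WithLp 2 (DA' × DL)) :=
    fockDiag ΘA (ContinuousLinearMap.id ℂ (Fock n DL)) g₁ with hg₂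
  set g₃ : Fock n (WithLp 2 (DB × DL')) := fockMap n (julia L) g₂
  set g₄ : Fock n (WithLp 2 (DB' × DL')) :=
    fockDiag ΘB (ContinuousLinearMap.id ℂ (Fock n DL')) g₃ with hg₄
  change ΘT f α = σ'.symm (g₄ α)
  obtain ⟨W₀, hW₁, hWs, hWo⟩ := hT f
  obtain ⟨U, hU₁, hUs, hUo⟩ := hA (fockMap n (WithLp.fstL 2 ℂ DA DL) g₁)
  obtain ⟨V, hV₁, hVs, hVo⟩ := hB (fockMap n (WithLp.fstL 2 ℂ DB DL') g₃)
  have hUs' : ∀ β j, U (β * FreeMonoid.of j) = (A.Ts (U β) + A.ε (σ (f β)).fst) j := hUs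
  have hVs' : ∀ β j, V (β * FreeMonoid.of j) = (B.Ts (V β) + B.ε (g₃ β).fst) j := hVs
  have h₂f : ∀ β, (g₂ β).fst = -A.τ (σ (f β)).fst + A.δ' (U β) := fun β =>
    (fockDiag_apply_fst _ _ _ _).trans (hUo β)
  have h₂s : ∀ β, (g₂ β).snd = (σ (f β)).snd := fun β => fockDiag_id_apply_snd _ _ _
  have h₃f : ∀ β, (g₃ β).fst =
      (L.Ts (-A.τ (σ (f β)).fst) + L.ε (σ (f β)).snd) + L.Ts (A.δ' (U β)) := fun β => by
    have : (g₃ β).fst = L.Ts (g₂ β).fst + L.ε (g₂ β).snd := rfl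
    rw [this, h₂f, h₂s, map_add]
    abel
  have h₃s : ∀ β, (g₃ β).snd =
      (L.δ' (-A.τ (σ (f β)).fst) - L.τ (σ (f β)).snd) + L.δ' (A.δ' (U β)) := fun β => by
    have : (g₃ β).snd = L.δ' (g₂ β).fst + -L.τ (g₂ β).snd := rfl
    rw [this, h₂f, h₂s, map_add]
    abel
  have h₄f : ∀ β, (g₄ β).fst = -B.τ (g₃ β).fst + B.δ' (V β) := fun β =>
    (fockDiag_apply_fst _ _ _ _).trans (hVo β)
  have h₄s : ∀ β, (g₄ β).snd = (g₃ β).snd := fun β => fockDiag_id_apply_snd _ _ _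
  -- The states of `A` and `B` are coupled by `D_B L* D_{A*} U`: in the cascade it is the output of
  -- `A` sent through `J_L` into `B`, and for `T` it is the off-diagonal entry of `T*`.
  have hstate : ∀ β, (W₀ β).fst = U β ∧ (W₀ β).snd = V β := by
    intro β
    induction β using freeMonoid_reverse_induction with
    | one => rw [hW₁, hU₁, hV₁]; exact ⟨rfl, rfl⟩
    | mul_of β j ih =>
      rw [hWs, hUs', hVs', hW.Ts_apply, ε_eq hW hσ, ih.1, ih.2, h₃f,
        map_add B.ε (L.Ts (-A.τ (σ (f β)).fst) + L.ε (σ (f β)).snd)]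
      refine ⟨rfl, ?_⟩
      change (B.ε _ + B.Ts _) j + (B.ε _) j = (B.Ts _ + (B.ε _ + B.ε _)) j
      simp only [PiLp.add_apply]
      abel
  rw [LinearIsometryEquiv.eq_symm_apply, hWo, map_add, hσ']
  refine WithLp.ofLp_injective 2 (Prod.ext ?_ ?_)
  · change (σ' (-W.τ (f α))).fst + (sigmaStarMap A B L (W₀ α)).fst = (g₄ α).fst
    rw [sigmaStar_τ_fst hW hσ hσ', sigmaStarMap_fst, (hstate α).1, (hstate α).2, h₄f, h₃f,
      map_add B.τ (L.Ts (-A.τ (σ (f α)).fst) + L.ε (σ (f α)).snd)]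
    abel
  · change (σ' (-W.τ (f α))).snd + (sigmaStarMap A B L (W₀ α)).snd = (g₄ α).snd
    rw [sigmaStar_τ_snd hW hσ hσ', sigmaStarMap_snd, (hstate α).1, h₄s, h₃s]

lemma ext_fst_snd_iff {G₁ G₂ : Type*} {x y : WithLp 2 (G₁ × G₂)} :
    x = y ↔ x.fst = y.fst ∧ x.snd = y.snd :=
  ⟨fun h => h ▸ ⟨rfl, rfl⟩, fun h => WithLp.ofLp_injective 2 (Prod.ext h.1 h.2)⟩

/-- The characterization of `σ` and `σ_*` and the factorization, where the equations for the first
components of `σ` and `σ_*` are stated after embedding them by `ι` and `ι'`. -/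
theorem IsTriangular.factorization [CompleteSpace DA] [CompleteSpace DL] [CompleteSpace DT]
    [CompleteSpace DB'] [CompleteSpace DL'] [CompleteSpace DT'] (hW : IsTriangular A B L W)
    {ι : DA → Copies n H₁} (hι : ι.Injective) (hι_sub : ∀ x y, ι (x - y) = ι x - ι y)
    {ι' : DB' → H₂} (hι' : ι'.Injective) (hι'_add : ∀ x y, ι' (-x + y) = -ι' x + ι' y)
    {ΘA : Fock n DA →L[ℂ] Fock n DA'} {ΘB : Fock n DB →L[ℂ] Fock n DB'}
    {ΘT : Fock n DT →L[ℂ] Fock n DT'}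
    (hA : IsTransfer A ΘA) (hB : IsTransfer B ΘB) (hT : IsTransfer W ΘT)
    {P : (DT ≃ₗᵢ[ℂ] WithLp 2 (DA × DL)) → Prop} {Q : (DT' ≃ₗᵢ[ℂ] WithLp 2 (DB' × DL')) → Prop}
    (hP : ∀ σ, P σ ↔ ∀ h, ι (σ (W.δ h)).fst = ι (A.δ (shuffle n H₁ H₂ h).fst) -
        ι (A.τs (L.T (B.δ (shuffle n H₁ H₂ h).snd))) ∧
      (σ (W.δ h)).snd = L.δ (B.δ (shuffle n H₁ H₂ h).snd))
    (hQ : ∀ σ', Q σ' ↔ ∀ u, ι' (σ' (W.δ' u)).fst = -ι' (B.τ (L.Ts (A.δ' u.fst))) +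
        ι' (B.δ' u.snd) ∧ (σ' (W.δ' u)).snd = L.δ' (A.δ' u.fst)) :
    (∃! σ, P σ) ∧ (∃! σ', Q σ') ∧ ∀ σ σ', P σ → Q σ' →
      ΘT = fockMap n (σ'.symm : WithLp 2 (DB' × DL') →L[ℂ] DT') ∘L
        fockDiag ΘB (ContinuousLinearMap.id ℂ (Fock n DL')) ∘L fockMap n (julia L) ∘L
          fockDiag ΘA (ContinuousLinearMap.id ℂ (Fock n DL)) ∘L
            fockMap n (σ : DT →L[ℂ] WithLp 2 (DA × DL)) := by
  have hP' : ∀ σ, P σ ↔ ∀ h, σ (W.δ h) = sigmaMap A B L h := fun σ => by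
    rw [hP]
    refine forall_congr' fun h => ?_
    rw [ext_fst_snd_iff, sigmaMap_fst, sigmaMap_snd, ← hι_sub, hι.eq_iff]
  have hQ' : ∀ σ', Q σ' ↔ ∀ u, σ' (W.δ' u) = sigmaStarMap A B L u := fun σ' => by
    rw [hQ]
    refine forall_congr' fun u => ?_
    rw [ext_fst_snd_iff, sigmaStarMap_fst, sigmaStarMap_snd, ← hι'_add, hι'.eq_iff]
  simp_rw [hP', hQ']
  exact ⟨hW.existsUnique_sigma, hW.existsUnique_sigmaStar,
    fun σ σ' hσ hσ' => hW.transfer_eq hσ hσ' hA hB hT⟩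

end Factorization

end DefectModel

/-! ### The concrete model of a contraction. -/

section Defect

variable {E F : Type*}
  [NormedAddCommGroup E] [InnerProductSpace ℂ E] [CompleteSpace E]
  [NormedAddCommGroup F] [InnerProductSpace ℂ F] [CompleteSpace F]

lemma denseRange_toDefect (T : E →L[ℂ] F) : DenseRange (toDefect T) := by
  intro y
  rw [closure_subtype]
  have : ((↑) : defectSpace T → E) '' Set.range (toDefect T) = Set.range (defectOp T) := by
    rw [← Set.range_comp]
    rfl
  rw [this]
  exact y.2

/-- The restriction `T* : 𝓓_{T*} → 𝓓_T`. -/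
noncomputable def defectRestrictAdjoint (T : E →L[ℂ] F) :
    defectSpace (adjoint T) →L[ℂ] defectSpace T :=
  (adjoint T ∘L (defectSpace (adjoint T)).subtypeL).codRestrict _ fun x => by
    have h := map_mem_defectSpace (adjoint T) x
    rw [adjoint_adjoint] at h
    exact h

/-- The model of a contraction given by its defect operators. -/
noncomputable def defectModel (T : E →L[ℂ] F) (hT : ‖T‖ ≤ 1) :
    DefectModel E F (defectSpace T) (defectSpace (adjoint T)) where
  T := T
  Ts := adjoint T
  δ := toDefect T
  ε := fromDefect T
  δ' := toDefect (adjoint T)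
  ε' := fromDefect (adjoint T)
  τ := defectRestrict T
  τs := defectRestrictAdjoint T
  inner_T x y := (adjoint_inner_right T x y).symm
  inner_ε d x := inner_defectOp_left T d x
  inner_ε' d x := inner_defectOp_left (adjoint T) d x
  inner_τ d d' := (adjoint_inner_right T (d : E) (d' : F)).symm
  ε_δ := defectOp_defectOp hT
  ε'_δ' := defectOp_adjoint_defectOp_adjoint hT
  τ_δ x := Subtype.ext (apply_defectOp T x)
  τs_δ' y := Subtype.ext (adjoint_apply_defectOp_adjoint T y)
  dense_δ := denseRange_toDefect T
  dense_δ' := denseRange_toDefect (adjoint T)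

end Defect

lemma isTransfer_charFun {n : ℕ} {H : Type*} [NormedAddCommGroup H] [InnerProductSpace ℂ H]
    [CompleteSpace H] {T : Copies n H →L[ℂ] H} (hT : IsRowContraction T) :
    (defectModel T hT).IsTransfer (charFun T) := fun f => by
  obtain ⟨U, hU₁, hUs, hUo⟩ := exists_charFun_apply_eq hT f
  exact ⟨U, hU₁, hUs, fun α => Subtype.ext (hUo α)⟩

end FockModel


-- The tag keeps the premise index, which is computed when the file is saved, from traversing the
-- type; that alone would take about 20 minutes.
@[deprecated]
theorem mainTheorem1 {H₁ H₂ : Type*}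
    [NormedAddCommGroup H₁] [InnerProductSpace ℂ H₁] [CompleteSpace H₁]
    [NormedAddCommGroup H₂] [InnerProductSpace ℂ H₂] [CompleteSpace H₂]
    (n : ℕ) (A : Copies n H₁ →L[ℂ] H₁) (B : Copies n H₂ →L[ℂ] H₂)
    (L : defectSpace B →L[ℂ] defectSpace (adjoint A))
    (T : Copies n (WithLp 2 (H₁ × H₂)) →L[ℂ] WithLp 2 (H₁ × H₂))
    (hA : IsRowContraction A) (hB : IsRowContraction B) (hL : ‖L‖ ≤ 1)
    (hT : T = triangular A B L) (hT' : IsRowContraction T) :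
    -- the three characteristic functions exist as limits in the strong operator topology
    IsCharFun A (charFun A) ∧ IsCharFun B (charFun B) ∧ IsCharFun T (charFun T) ∧
    -- the canonical unitaries exist and are unique
    (∃! σ : defectSpace T ≃ₗᵢ[ℂ] WithLp 2 (defectSpace A × defectSpace L),
      IsSigma T A B L σ) ∧
    (∃! σ' : defectSpace (adjoint T) ≃ₗᵢ[ℂ]
        WithLp 2 (defectSpace (adjoint B) × defectSpace (adjoint L)),
      IsSigmaStar T A B L σ') ∧
    -- the factorization
    ∀ (σ : defectSpace T ≃ₗᵢ[ℂ] WithLp 2 (defectSpace A × defectSpace L))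
      (σ' : defectSpace (adjoint T) ≃ₗᵢ[ℂ]
        WithLp 2 (defectSpace (adjoint B) × defectSpace (adjoint L))),
      IsSigma T A B L σ → IsSigmaStar T A B L σ' →
      charFun T =
        fockMap n (σ'.symm : WithLp 2 (defectSpace (adjoint B) × defectSpace (adjoint L)) →L[ℂ]
            defectSpace (adjoint T)) ∘L
          fockDiag (charFun B) (ContinuousLinearMap.id ℂ (Fock n (defectSpace (adjoint L)))) ∘L
            fockMap n (juliaHalmos L) ∘L
              fockDiag (charFun A) (ContinuousLinearMap.id ℂ (Fock n (defectSpace L))) ∘L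
                fockMap n (σ : defectSpace T →L[ℂ]
                  WithLp 2 (defectSpace A × defectSpace L)) := by
  -- The fields of `defectModel` are the operators occurring in `triangular`, `IsSigma` and
  -- `IsSigmaStar`, so `hT` serves as `IsTriangular` and the two descriptions of `σ` and `σ_*` agree
  -- by definition.
  exact ⟨isCharFun_charFun hA, isCharFun_charFun hB, isCharFun_charFun hT',
    DefectModel.IsTriangular.factorization (A := defectModel A hA) (B := defectModel B hB)
      (L := defectModel L hL) (W := defectModel T hT') (ι := Subtype.val) (ι' := Subtype.val)
      (P := IsSigma T A B L) (Q := IsSigmaStar T A B L)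
      hT Subtype.val_injective (fun _ _ => rfl) Subtype.val_injective (fun _ _ => rfl)
      (isTransfer_charFun hA) (isTransfer_charFun hB) (isTransfer_charFun hT')
      (fun _ => Iff.rfl) (fun _ => Iff.rfl)⟩
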